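/- Let $P$ be a regular $n$-gon with unit circumradius, $n\ge 5$, with vertices $p_1,\dots,p_n$ in counterclockwise order and sides $S_i=p_ip_{i+1}$ (indices mod $n$). A convex polygon $Q$ is \emph{circumscribed} about $P$ if $P\subseteq Q$ and every vertex of $P$ lies on the boundary of $Q$; let $A(P)=\sup\{\operatorname{area}(Q): Q \text{ circumscribed about } P\}$, and call $Q$ a \emph{maximum area polygon circumscribed about} $P$ if $Q$ is circumscribed about $P$ and $\operatorname{area}(Q)=A(P)$. The \emph{sequence assigned to} $Q$ is the word in $\{U,N\}^n$ whose $i$-th letter is $U$ if $S_i$ is contained in the boundary of $Q$ (used), and $N$ otherwise (not used). Then $A(P)$ is finite and the following hold. \begin{enumerate} \item If $2\mid n$, then \[A(P)=n\tan\frac{\pi}{n}+\frac n2\,\frac{\sin^4\frac{\pi}{n}}{\cos^2\frac{\pi}{n}}\tan\frac{2\pi}{n},\] and the sequence assigned to a maximum area polygon circumscribed about $P$ is $w=(UN)^{n/2}=UNUN\ldots UN$. \item If $4\mid n-1$, then \[A(P)=n\tan\frac{\pi}{n}+\frac{\sin^4\frac{\pi}{n}}{\cos^2\frac{\pi}{n}}\left(\frac{n+3}{4}\tan\frac{2\pi}{n}-\tan\frac{3\pi}{2n}\right),\]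 and the sequence assigned to a maximum area polygon circumscribed about $P$ is $w=U\,N^{\frac{n-5}{2}}\,(UN)^{\frac{n+3}{4}}$. \item If $4\mid n+1$, then \[A(P)=n\tan\frac{\pi}{n}+\frac{\sin^4\frac{\pi}{n}}{\cos^2\frac{\pi}{n}}\left(\frac{n+1}{4}\tan\frac{2\pi}{n}-\tan\frac{\pi}{2n}\right),\] and the sequence assigned to a maximum area polygon circumscribed about $P$ is $w=U\,N^{\frac{n-3}{2}}\,(UN)^{\frac{n+1}{4}}$. \end{enumerate} Here the assertion about sequences means that there is a maximum area polygon circumscribed about $P$ with assigned sequence exactly $w$, and that the sequence assigned to every maximum area polygon circumscribed about $P$ is a cyclic shift of $w$. -/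

import Mathlib

open MeasureTheory

noncomputable section

namespace CircumscribedPolygon

/-- The Euclidean plane. -/
abbrev Plane : Type := EuclideanSpace ℝ (Fin 2)

/-- A (solid, nondegenerate) convex polygon: the convex hull of finitely many points, with nonempty
interior. -/
def IsConvexPolygon (Q : Set Plane) : Prop :=
  (∃ F : Set Plane, F.Finite ∧ Q = convexHull ℝ F) ∧ (interior Q).Nonempty

/-- The area of a plane set: its Lebesgue measure. -/
def area (Q : Set Plane) : ℝ := (volume Q).toReal

/-- `Q` is circumscribed about the convex polygon with vertices `p i`, `i : ZMod n`: it is a convex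
polygon that contains the polygon and has all the points `p i` on its boundary. -/
def IsCircumscribed {n : ℕ} (p : ZMod n → Plane) (Q : Set Plane) : Prop :=
  IsConvexPolygon Q ∧ convexHull ℝ (Set.range p) ⊆ Q ∧ ∀ i, p i ∈ frontier Q

/-- The set of areas of the polygons circumscribed about the polygon with vertices `p i`. -/
def circumscribedAreas {n : ℕ} (p : ZMod n → Plane) : Set ℝ :=
  {a | ∃ Q, IsCircumscribed p Q ∧ area Q = a}

/-- `A(P)`: the supremum of the areas of circumscribed polygons. -/
def maxArea {n : ℕ} (p : ZMod n → Plane) : ℝ := sSup (circumscribedAreas p)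

/-- `Q` is a maximum area polygon circumscribed about the polygon with vertices `p i`. -/
def IsMaxAreaCircumscribed {n : ℕ} (p : ZMod n → Plane) (Q : Set Plane) : Prop :=
  IsCircumscribed p Q ∧ area Q = maxArea p

/-- The labels "used" and "not used". -/
inductive Label : Type
  | U : Label
  | N : Label

/-- The side joining `p i` and `p (i + 1)`, with indices modulo `n`. -/
def side {n : ℕ} (p : ZMod n → Plane) (i : ZMod n) : Set Plane := segment ℝ (p i) (p (i + 1))

open Classical in
/-- The label of the `i`-th side: used by `Q` if it lies on the boundary of `Q`. -/
def sideLabel {n : ℕ} (p : ZMod n → Plane) (Q : Set Plane) (i : ZMod n) : Label :=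
  if side p i ⊆ frontier Q then Label.U else Label.N

/-- The sequence of length `n` of the labels of the sides, in the order of the vertices. -/
def assignedSequence {n : ℕ} (p : ZMod n → Plane) (Q : Set Plane) : List Label :=
  List.ofFn fun i : Fin n => sideLabel p Q ((i : ℕ) : ZMod n)

/-- The points `p i` are the vertices, in counterclockwise order, of a regular `n`-gon with unit
circumradius (with arbitrary center `c` and arbitrary position). -/
def IsUnitRegularNgon {n : ℕ} (p : ZMod n → Plane) : Prop :=
  ∃ (c : Plane) (φ : ℝ), ∀ k : ℕ,
    p (k : ZMod n) =
      c + !₂[Real.cos (φ + 2 * Real.pi * k / n), Real.sin (φ + 2 * Real.pi * k / n)]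

/-- The word `UNUN…UN` consisting of `k` blocks `UN`. -/
def wordUN (k : ℕ) : List Label := (List.replicate k [Label.U, Label.N]).flatten

/-- The word `U N…N UNUN…UN` with `m` letters `N` after the first `U`, followed by `k` blocks
`UN`. -/
def wordUNUN (m k : ℕ) : List Label := Label.U :: (List.replicate m Label.N ++ wordUN k)

end CircumscribedPolygon

end

/-!
Put `α = π / n`. A circumscribed polygon has a supporting line at every vertex of `P`; measure its
slope against the tangent of the circumcircle by a number `z i ∈ [-1, 1]`, with `±1` for a line
along a side. Over each side the supporting lines at its two ends enclose a triangle whose area, in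
units of the area `sin (2 α) / 2` of the triangle spanned by the centre and the side, is an excess
`A B / (A + B - A B)` with `A` and `B` affine in the two slopes. The excess vanishes exactly when
the side is used, and the area is `sin (2 α) / 2` times `n` plus the total excess.

At a maximum, balance at each vertex makes the two adjacent excesses determine its slope.
Eliminating the slopes leaves the linear recurrence
`h (i - 1) + 2 cos (2 α) h i + h (i + 1) = 2 (1 - cos (2 α))` along any run of unused sides, with
`h = 0` at the used sides that bound it. Comparing its solution with a homogeneous solution
symmetric about the middle of the run evaluates the sum of `h - tan² α` over a gap of length `l`
between consecutive used sides: `tan³ α tan (2 α)` if `l = 2`, at most `0` for the other even `l`,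
and `tan³ α tan (l α - π / 2)` for odd `l`. Gaps of length two are therefore best, and suffice if
`n` is even; if `n` is odd, exactly one gap is odd, and the best choice is the longest odd gap of
length below `n / 2`.
-/

noncomputable section

namespace CircumscribedPolygon

open Real Set

/-- The area of the corner of a circumscribed polygon beyond a side, relative to the area of the
triangle spanned by the centre and that side. In the affine coordinates in which the centre is the
origin and the ends of the side are the unit points, the supporting lines through the ends of the
side are `x + (1 - A) * y = 1` and `(1 - B) * x + y = 1`. -/
def excess (A B : ℝ) : ℝ := A * B / (A + B - A * B)

theorem excess_comm (A B : ℝ) : excess A B = excess B A := by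
  unfold excess
  rw [mul_comm, add_comm]

@[simp] theorem excess_zero_left (B : ℝ) : excess 0 B = 0 := by simp [excess]

@[simp] theorem excess_zero_right (A : ℝ) : excess A 0 = 0 := by simp [excess]

theorem excess_denom_pos {A B : ℝ} (hA : A ∈ Ico 0 2) (hB : B ∈ Ico 0 2) (h : 0 < A + B) :
    0 < A + B - A * B := by
  obtain ⟨hA0, hA2⟩ := hA
  obtain ⟨hB0, hB2⟩ := hB
  rcases hA0.eq_or_lt with rfl | hA0
  · linarith
  · nlinarith [mul_pos hA0 (sub_pos.2 hB2), mul_nonneg hB0 (sub_pos.2 hA2).le]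

theorem excess_pos {A B : ℝ} (hA : A ∈ Ioo 0 2) (hB : B ∈ Ioo 0 2) : 0 < excess A B :=
  div_pos (mul_pos hA.1 hB.1) <|
    excess_denom_pos (Ioo_subset_Ico_self hA) (Ioo_subset_Ico_self hB) (add_pos hA.1 hB.1)

theorem excess_pos_iff {A B : ℝ} (hA : A ∈ Ico 0 2) (hB : B ∈ Ico 0 2) :
    0 < excess A B ↔ 0 < A ∧ 0 < B := by
  refine ⟨fun h => ⟨hA.1.lt_of_ne ?_, hB.1.lt_of_ne ?_⟩,
    fun h => excess_pos ⟨h.1, hA.2⟩ ⟨h.2, hB.2⟩⟩ <;>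
  · rintro rfl
    simp at h

theorem excess_nonneg {A B : ℝ} (hA : A ∈ Ico 0 2) (hB : B ∈ Ico 0 2) : 0 ≤ excess A B := by
  rcases hA.1.eq_or_lt with rfl | hA0
  · simp
  rcases hB.1.eq_or_lt with rfl | hB0
  · simp
  · exact (excess_pos ⟨hA0, hA.2⟩ ⟨hB0, hB.2⟩).le

theorem excess_le_right {A B : ℝ} (hA : A ∈ Icc 0 1) (hB : 0 ≤ B) : excess A B ≤ B := by
  have hden : 0 ≤ A + B - A * B := by nlinarith [hA.1, mul_nonneg hB (sub_nonneg.2 hA.2)]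
  refine div_le_of_le_mul₀ hden hB ?_
  nlinarith [mul_nonneg (sq_nonneg B) (sub_nonneg.2 hA.2)]

theorem continuousOn_excess :
    ContinuousOn (fun x : ℝ × ℝ => excess x.1 x.2) (Ico 0 2 ×ˢ Ico 0 2) := by
  rintro ⟨A, B⟩ ⟨hA, hB⟩
  rcases (add_nonneg hA.1 hB.1).lt_or_eq with h | h
  · have hnum : ContinuousAt (fun x : ℝ × ℝ => x.1 * x.2) (A, B) := by fun_prop
    have hden : ContinuousAt (fun x : ℝ × ℝ => x.1 + x.2 - x.1 * x.2) (A, B) := by fun_prop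
    exact (hnum.div hden (excess_denom_pos hA hB h).ne').continuousWithinAt
  obtain ⟨rfl, rfl⟩ : A = 0 ∧ B = 0 := ⟨by linarith [hA.1, hB.1], by linarith [hA.1, hB.1]⟩
  have hsnd : Filter.Tendsto (fun x : ℝ × ℝ => x.2) (nhdsWithin (0, 0) (Ico 0 2 ×ˢ Ico 0 2))
      (nhds 0) := (continuous_snd.tendsto (0, 0)).mono_left nhdsWithin_le_nhds
  have hfst : ∀ᶠ x : ℝ × ℝ in nhdsWithin (0, 0) (Ico 0 2 ×ˢ Ico 0 2), x.1 ≤ 1 :=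
    nhdsWithin_le_nhds <| (continuous_fst.tendsto ((0 : ℝ), (0 : ℝ))).eventually_le_const one_pos
  unfold ContinuousWithinAt
  simp only [excess_zero_left]
  refine squeeze_zero' ?_ ?_ hsnd
  · filter_upwards [self_mem_nhdsWithin] with x hx using excess_nonneg hx.1 hx.2
  · filter_upwards [self_mem_nhdsWithin, hfst] with x hx hx1
      using excess_le_right ⟨hx.1.1, hx1⟩ hx.2.1

theorem hasDerivAt_excess_right {A B : ℝ} (h : A + B - A * B ≠ 0) :
    HasDerivAt (excess A) ((A / (A + B - A * B)) ^ 2) B := by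
  have hnum : HasDerivAt (fun x : ℝ => A * x) A B := by
    simpa using (hasDerivAt_id B).const_mul A
  have hden : HasDerivAt (fun x : ℝ => A + x - A * x) (1 - A) B :=
    ((hasDerivAt_id B).const_add A).sub hnum
  refine (hnum.div hden h).congr_deriv ?_
  rw [div_pow]
  congr 1
  ring

theorem hasDerivAt_excess_left {A B : ℝ} (h : A + B - A * B ≠ 0) :
    HasDerivAt (fun x => excess x B) ((B / (A + B - A * B)) ^ 2) A := by
  have hden : B + A - B * A = A + B - A * B := by ring
  have hderiv := hasDerivAt_excess_right (A := B) (B := A) (by rwa [hden])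
  rwa [hden, funext (excess_comm B)] at hderiv

theorem mul_one_sub_mem_Ico {M r : ℝ} (hM0 : 0 ≤ M) (hM1 : M < 1) (hr : r ∈ Icc (-1) 1) :
    M * (1 - r) ∈ Ico 0 2 :=
  ⟨mul_nonneg hM0 (by linarith [hr.2]), by nlinarith [hr.1]⟩

theorem mul_one_add_mem_Ico {M r : ℝ} (hM0 : 0 ≤ M) (hM1 : M < 1) (hr : r ∈ Icc (-1) 1) :
    M * (1 + r) ∈ Ico 0 2 :=
  ⟨mul_nonneg hM0 (by linarith [hr.1]), by nlinarith [hr.2]⟩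

theorem excess_balance_of_isMaxOn {M A B s : ℝ} (hM0 : 0 < M) (hM1 : M < 1)
    (hA : A ∈ Ico 0 2) (hB : B ∈ Ico 0 2) (hs : s ∈ Icc (-1) 1)
    (hmax : IsMaxOn (fun r => excess A (M * (1 + r)) + excess (M * (1 - r)) B) (Icc (-1) 1) s) :
    (1 - s) * excess A (M * (1 + s)) = (1 + s) * excess (M * (1 - s)) B := by
  rcases hs.1.eq_or_lt with rfl | hs0
  · simp
  rcases hs.2.eq_or_lt with rfl | hs1
  · simp
  have hb : 0 < M * (1 + s) := mul_pos hM0 (by linarith)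
  have ha : 0 < M * (1 - s) := mul_pos hM0 (by linarith)
  have hD := excess_denom_pos hA (mul_one_add_mem_Ico hM0.le hM1 hs) (by linarith [hA.1])
  have hE := excess_denom_pos (mul_one_sub_mem_Ico hM0.le hM1 hs) hB (by linarith [hB.1])
  have hderiv_b : HasDerivAt (fun r : ℝ => M * (1 + r)) M s := by
    simpa using ((hasDerivAt_id s).const_add 1).const_mul M
  have hderiv_a : HasDerivAt (fun r : ℝ => M * (1 - r)) (-M) s := by
    simpa using ((hasDerivAt_id s).const_sub 1).const_mul M
  have hderiv := ((hasDerivAt_excess_right hD.ne').comp s hderiv_b).add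
    ((hasDerivAt_excess_left hE.ne').comp s hderiv_a)
  have hlocal : IsLocalMax ((excess A ∘ fun r => M * (1 + r)) +
      ((fun x => excess x B) ∘ fun r => M * (1 - r))) s :=
    hmax.isLocalMax (Icc_mem_nhds hs0 hs1)
  have hcrit := hlocal.hasDerivAt_eq_zero hderiv
  have hsq : (A / (A + M * (1 + s) - A * (M * (1 + s)))) ^ 2 =
      (B / (M * (1 - s) + B - M * (1 - s) * B)) ^ 2 :=
    mul_right_cancel₀ hM0.ne' (by linarith)
  have hratio := (sq_eq_sq₀ (div_nonneg hA.1 hD.le) (div_nonneg hB.1 hE.le)).1 hsq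
  unfold excess
  rw [mul_div_right_comm, hratio, mul_comm (M * (1 - s)) B, mul_div_right_comm B,
    mul_comm B (M * (1 - s))]
  ring

/-- Eliminating the slopes `s` and `t` of the supporting lines at the ends of a side from the two
balance equations there leaves a linear recurrence for consecutive excesses. -/
theorem excess_recurrence_of_balance {M s t x y : ℝ}
    (hpos_left : 0 < M * (1 - s)) (hpos_right : 0 < M * (1 + t))
    (hden : M * (1 - s) + M * (1 + t) - M * (1 - s) * (M * (1 + t)) ≠ 0)
    (hx : (1 - s) * x = (1 + s) * excess (M * (1 - s)) (M * (1 + t)))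
    (hy : (1 - t) * excess (M * (1 - s)) (M * (1 + t)) = (1 + t) * y) :
    x + 2 * (1 - M) * excess (M * (1 - s)) (M * (1 + t)) + y = 2 * M := by
  have hmul : excess (M * (1 - s)) (M * (1 + t)) *
      (M * (1 - s) + M * (1 + t) - M * (1 - s) * (M * (1 + t))) =
      M * (1 - s) * (M * (1 + t)) := div_mul_cancel₀ _ hden
  apply mul_left_cancel₀ (mul_pos hpos_left hpos_right).ne'
  linear_combination M ^ 2 * (1 + t) * hx - M ^ 2 * (1 - s) * hy + 2 * M * hmul

section Slopes

variable {n : ℕ}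

/-- The excess over the side `i` when the supporting line at the `i`-th vertex has slope `z i`,
measured against the tangent of the circumscribed circle and normalized so that the lines through
the two adjacent sides have slopes `-1` and `1`; here `M = 1 - cos (2 * π / n)`. -/
def sideExcess (M : ℝ) (z : ZMod n → ℝ) (i : ZMod n) : ℝ :=
  excess (M * (1 - z i)) (M * (1 + z (i + 1)))

theorem slope_mem_Icc {z : ZMod n → ℝ} (hz : z ∈ Icc (-1) 1) (i : ZMod n) : z i ∈ Icc (-1) 1 :=
  ⟨hz.1 i, hz.2 i⟩

theorem sideExcess_nonneg {M : ℝ} (hM0 : 0 ≤ M) (hM1 : M < 1) {z : ZMod n → ℝ}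
    (hz : z ∈ Icc (-1) 1) (i : ZMod n) : 0 ≤ sideExcess M z i :=
  excess_nonneg (mul_one_sub_mem_Ico hM0 hM1 (slope_mem_Icc hz i))
    (mul_one_add_mem_Ico hM0 hM1 (slope_mem_Icc hz (i + 1)))

/-- In an optimal polygon the excesses over the sides at a vertex are proportional to `1 + z` and
`1 - z`, which determines the slope `z` at that vertex. -/
theorem exists_sideExcess_eq {M : ℝ} (hM0 : M ≠ 0) {h : ZMod n → ℝ} (hnonneg : ∀ i, 0 ≤ h i)
    (hrec : ∀ i, 0 < h (i + 1) → h i + 2 * (1 - M) * h (i + 1) + h (i + 1 + 1) = 2 * M)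
    (hzero : ∀ i, h (i + 1) = 0 → 0 < h i ∨ 0 < h (i + 1 + 1)) :
    ∃ z : ZMod n → ℝ, z ∈ Icc (-1) 1 ∧ ∀ i, sideExcess M z i = h i := by
  have hmem : ∀ x y : ℝ, 0 ≤ x → 0 ≤ y → (x - y) / (x + y) ∈ Icc (-1) 1 := by
    intro x y hx hy
    rcases (add_nonneg hx hy).lt_or_eq with h | h
    · exact ⟨by rw [le_div_iff₀ h]; linarith, by rw [div_le_iff₀ h]; linarith⟩
    · simp [← h]
  refine ⟨fun i => (h (i - 1) - h i) / (h (i - 1) + h i),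
    ⟨fun i => (hmem _ _ (hnonneg _) (hnonneg _)).1, fun i => (hmem _ _ (hnonneg _) (hnonneg _)).2⟩,
    fun i => ?_⟩
  obtain ⟨i, rfl⟩ : ∃ j, i = j + 1 := ⟨i - 1, by ring⟩
  rw [sideExcess]
  simp only [add_sub_cancel_right]
  have hx := hnonneg i
  have hw := hnonneg (i + 1 + 1)
  rcases (hnonneg (i + 1)).lt_or_eq with hy | hy
  · have hr := hrec i hy
    generalize h i = x at *
    generalize h (i + 1) = y at *
    generalize h (i + 1 + 1) = w at *
    have hleft : M * (1 - (x - y) / (x + y)) = 2 * M * y / (x + y) := by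
      field_simp
      ring
    have hright : M * (1 + (y - w) / (y + w)) = 2 * M * y / (y + w) := by
      field_simp
      ring
    have hden : 2 * M * y / (x + y) + 2 * M * y / (y + w) -
        2 * M * y / (x + y) * (2 * M * y / (y + w)) =
        2 * M * y * (2 * M) / ((x + y) * (y + w)) := by
      field_simp
      linear_combination hr
    rw [hleft, hright, excess, hden]
    field_simp
  · rw [← hy]
    rcases hzero i hy.symm with h | h <;> simp [h.ne']

variable [NeZero n]

/-- The total excess of the polygon whose supporting lines at the vertices have slopes `z`. -/
def totalExcess (M : ℝ) (z : ZMod n → ℝ) : ℝ := ∑ i, sideExcess M z i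

theorem continuousOn_totalExcess {M : ℝ} (hM0 : 0 ≤ M) (hM1 : M < 1) :
    ContinuousOn (totalExcess (n := n) M) (Icc (-1) 1) := by
  refine continuousOn_finsetSum _ fun i _ => continuousOn_excess.comp
    (f := fun z : ZMod n → ℝ => (M * (1 - z i), M * (1 + z (i + 1)))) (by fun_prop) fun z hz => ?_
  exact ⟨mul_one_sub_mem_Ico hM0 hM1 (slope_mem_Icc hz _),
    mul_one_add_mem_Ico hM0 hM1 (slope_mem_Icc hz _)⟩

theorem exists_isMaxOn_totalExcess {M : ℝ} (hM0 : 0 ≤ M) (hM1 : M < 1) :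
    ∃ z ∈ Icc (-1 : ZMod n → ℝ) 1, IsMaxOn (totalExcess M) (Icc (-1) 1) z :=
  isCompact_Icc.exists_isMaxOn ⟨0, by simp⟩ (continuousOn_totalExcess hM0 hM1)

theorem totalExcess_update_sub (hn : 2 ≤ n) (M : ℝ) (z : ZMod n → ℝ) (i : ZMod n) (r : ℝ) :
    totalExcess M (Function.update z (i + 1) r) - totalExcess M z =
      (excess (M * (1 - z i)) (M * (1 + r)) + excess (M * (1 - r)) (M * (1 + z (i + 1 + 1)))) -
        (sideExcess M z i + sideExcess M z (i + 1)) := by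
  have : Fact (1 < n) := ⟨hn⟩
  have hne : ∀ j : ZMod n, j ≠ j + 1 := fun j h => one_ne_zero (left_eq_add.1 h)
  unfold totalExcess sideExcess
  rw [← Finset.sum_sub_distrib, ← Finset.sum_subset (Finset.subset_univ {i, i + 1})]
  · rw [Finset.sum_pair (hne i)]
    simp only [Function.update_self, Function.update_of_ne (hne i),
      Function.update_of_ne (hne (i + 1)).symm]
    ring
  · intro j _ hj
    simp only [Finset.mem_insert, Finset.mem_singleton, not_or] at hj
    rw [Function.update_of_ne hj.2, Function.update_of_ne (fun h => hj.1 (add_right_cancel h)),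
      sub_self]

theorem sideExcess_balance_of_isMaxOn (hn : 2 ≤ n) {M : ℝ} (hM0 : 0 < M) (hM1 : M < 1)
    {z : ZMod n → ℝ} (hz : z ∈ Icc (-1) 1) (hmax : IsMaxOn (totalExcess M) (Icc (-1) 1) z)
    (i : ZMod n) :
    (1 - z (i + 1)) * sideExcess M z i = (1 + z (i + 1)) * sideExcess M z (i + 1) := by
  refine excess_balance_of_isMaxOn hM0 hM1
    (mul_one_sub_mem_Ico hM0.le hM1 (slope_mem_Icc hz i))
    (mul_one_add_mem_Ico hM0.le hM1 (slope_mem_Icc hz (i + 1 + 1)))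
    (slope_mem_Icc hz (i + 1)) fun r hr => ?_
  have hupdate : Function.update z (i + 1) r ∈ Icc (-1) 1 :=
    ⟨le_update_iff.2 ⟨hr.1, fun j _ => hz.1 j⟩, update_le_iff.2 ⟨hr.2, fun j _ => hz.2 j⟩⟩
  have hle : totalExcess M (Function.update z (i + 1) r) ≤ totalExcess M z := hmax hupdate
  have hsub := totalExcess_update_sub hn M z i r
  simp only [mem_ofPred_eq]
  unfold sideExcess at hsub
  linarith

theorem sideExcess_recurrence_of_isMaxOn (hn : 2 ≤ n) {M : ℝ} (hM0 : 0 < M) (hM1 : M < 1)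
    {z : ZMod n → ℝ} (hz : z ∈ Icc (-1) 1) (hmax : IsMaxOn (totalExcess M) (Icc (-1) 1) z)
    (i : ZMod n) (hi : 0 < sideExcess M z (i + 1)) :
    sideExcess M z i + 2 * (1 - M) * sideExcess M z (i + 1) + sideExcess M z (i + 1 + 1) =
      2 * M := by
  have hleft := mul_one_sub_mem_Ico hM0.le hM1 (slope_mem_Icc hz (i + 1))
  have hright := mul_one_add_mem_Ico hM0.le hM1 (slope_mem_Icc hz (i + 1 + 1))
  obtain ⟨hpos_left, hpos_right⟩ := (excess_pos_iff hleft hright).1 hi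
  exact excess_recurrence_of_balance hpos_left hpos_right
    (excess_denom_pos hleft hright (add_pos hpos_left hpos_right)).ne'
    (sideExcess_balance_of_isMaxOn hn hM0 hM1 hz hmax i)
    (sideExcess_balance_of_isMaxOn hn hM0 hM1 hz hmax (i + 1))

end Slopes

section Trigonometry

variable {α : ℝ}

theorem cos_pos_of_lt_pi_div_four (hα : α ∈ Ioo 0 (π / 4)) : 0 < cos α :=
  cos_pos_of_mem_Ioo ⟨by linarith [hα.1, pi_pos], by linarith [hα.2, pi_pos]⟩

theorem cos_two_mul_pos_of_lt_pi_div_four (hα : α ∈ Ioo 0 (π / 4)) : 0 < cos (2 * α) :=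
  cos_pos_of_mem_Ioo ⟨by linarith [hα.1, pi_pos], by linarith [hα.2, pi_pos]⟩

theorem sin_two_mul_pos_of_lt_pi_div_four (hα : α ∈ Ioo 0 (π / 4)) : 0 < sin (2 * α) :=
  sin_pos_of_pos_of_lt_pi (by linarith [hα.1]) (by linarith [hα.2, pi_pos])

theorem tan_pos_of_lt_pi_div_four (hα : α ∈ Ioo 0 (π / 4)) : 0 < tan α :=
  tan_pos_of_pos_of_lt_pi_div_two hα.1 (by linarith [hα.2, pi_pos])

theorem tan_two_mul_pos_of_lt_pi_div_four (hα : α ∈ Ioo 0 (π / 4)) : 0 < tan (2 * α) :=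
  tan_pos_of_pos_of_lt_pi_div_two (by linarith [hα.1]) (by linarith [hα.2])

theorem tan_sq_mul_one_add_cos_two_mul (hc : cos α ≠ 0) :
    tan α ^ 2 * (1 + cos (2 * α)) = 1 - cos (2 * α) := by
  rw [cos_two_mul, tan_eq_sin_div_cos]
  field_simp
  rw [sin_sq]
  ring

theorem tan_mul_one_add_cos_two_mul (hc : cos α ≠ 0) :
    tan α * (1 + cos (2 * α)) = sin (2 * α) := by
  rw [cos_two_mul, sin_two_mul, tan_eq_sin_div_cos]
  field_simp
  ring

theorem tan_sub_pi_div_two (x : ℝ) : tan (x - π / 2) = -cos x / sin x := by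
  rw [tan_eq_sin_div_cos, sin_sub_pi_div_two, cos_sub_pi_div_two]

theorem tan_add_sub_tan_sub_tan {a b : ℝ} (ha : cos a ≠ 0) (hb : cos b ≠ 0)
    (hab : cos (a + b) ≠ 0) :
    tan (a + b) - tan a - tan b = tan a * tan b * tan (a + b) := by
  simp only [tan_eq_sin_div_cos]
  field_simp
  rw [sin_add, cos_add]
  ring

theorem sin_add_add_sin_sub (x y : ℝ) : sin (x + y) + sin (x - y) = 2 * cos y * sin x := by
  rw [sin_add, sin_sub]
  ring

theorem cos_add_add_cos_sub (x y : ℝ) : cos (x + y) + cos (x - y) = 2 * cos y * cos x := by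
  rw [cos_add, cos_sub]
  ring

end Trigonometry

section Blocks

/-- The excesses over a maximal run of unused sides between two used ones: the sides `0` and `l`
are used, those in between are not and satisfy the recurrence of optimal polygons. -/
structure IsBlock (α : ℝ) (l : ℕ) (h : ℕ → ℝ) : Prop where
  pos : 0 < l
  left : h 0 = 0
  right : h l = 0
  inner : ∀ i, 0 < i → i < l → 0 < h i
  recurrence : ∀ i, i + 1 < l →
    h i + 2 * cos (2 * α) * h (i + 1) + h (i + 2) = 2 * (1 - cos (2 * α))

/-- A solution on `0, …, l` of the homogeneous recurrence of blocks that is symmetric under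
`i ↦ l - i`; the symmetry need only be required at the ends. -/
structure IsSymmSolution (α : ℝ) (l : ℕ) (u : ℕ → ℝ) : Prop where
  recurrence : ∀ i, u i + 2 * cos (2 * α) * u (i + 1) + u (i + 2) = 0
  right : u l = u 0
  left : u (l - 1) = u 1

theorem isSymmSolution_sin (α : ℝ) {l : ℕ} (hl : Odd l) :
    IsSymmSolution α l fun i => (-1) ^ i * sin ((l - 2 * i) * α) where
  recurrence i := by
    have hadd := sin_add_add_sin_sub ((l - 2 * (i + 1)) * α) (2 * α)
    have hprev : (l - 2 * (i + 1)) * α + 2 * α = (l - 2 * i) * α := by ring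
    have hnext : (l - 2 * (i + 1)) * α - 2 * α = (l - 2 * (i + 2)) * α := by ring
    rw [hprev, hnext] at hadd
    push_cast
    linear_combination (-1) ^ i * hadd
  right := by
    rw [hl.neg_one_pow, show ((l : ℝ) - 2 * l) * α = -((l - 2 * (0 : ℕ)) * α) by push_cast; ring,
      sin_neg]
    simp
  left := by
    have heven : Even (l - 1) := Nat.Odd.sub_odd hl odd_one
    rw [heven.neg_one_pow, Nat.cast_sub hl.pos,
      show ((l : ℝ) - 2 * (l - (1 : ℕ))) * α = -((l - 2 * (1 : ℕ)) * α) by push_cast; ring, sin_neg]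
    ring

theorem isSymmSolution_cos (α : ℝ) {l : ℕ} (hl0 : 0 < l) (hl : Even l) :
    IsSymmSolution α l fun i => (-1) ^ i * cos ((l - 2 * i) * α) where
  recurrence i := by
    have hadd := cos_add_add_cos_sub ((l - 2 * (i + 1)) * α) (2 * α)
    have hprev : (l - 2 * (i + 1)) * α + 2 * α = (l - 2 * i) * α := by ring
    have hnext : (l - 2 * (i + 1)) * α - 2 * α = (l - 2 * (i + 2)) * α := by ring
    rw [hprev, hnext] at hadd
    push_cast
    linear_combination (-1) ^ i * hadd
  right := by
    rw [hl.neg_one_pow, show ((l : ℝ) - 2 * l) * α = -((l - 2 * (0 : ℕ)) * α) by push_cast; ring,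
      cos_neg]
    simp
  left := by
    have hodd : Odd (l - 1) := Nat.Even.sub_odd hl0 hl odd_one
    rw [hodd.neg_one_pow, Nat.cast_sub hl0,
      show ((l : ℝ) - 2 * (l - (1 : ℕ))) * α = -((l - 2 * (1 : ℕ)) * α) by push_cast; ring, cos_neg,
      pow_one]

namespace IsBlock

variable {α : ℝ} {l : ℕ} {h : ℕ → ℝ}

/-- The Casoratian of `h - tan α ^ 2` with a symmetric solution `u` of the homogeneous recurrence
is constant; comparing its values at the two ends determines the sum of the extreme inner excesses
without solving the recurrence. -/
theorem add_mul_of_symm (hb : IsBlock α l h) (hc : cos α ≠ 0) {u : ℕ → ℝ}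
    (hu : IsSymmSolution α l u) :
    (h 1 + h (l - 1) - 2 * tan α ^ 2) * u 0 = -2 * tan α ^ 2 * u 1 := by
  have hcasoratian : ∀ i < l, (h (i + 1) - tan α ^ 2) * u i - (h i - tan α ^ 2) * u (i + 1) =
      (h 1 - tan α ^ 2) * u 0 + tan α ^ 2 * u 1 := by
    intro i hi
    induction i with
    | zero =>
      rw [hb.left]
      ring
    | succ i ih =>
      linear_combination ih (by omega) + u (i + 1) * hb.recurrence i hi -
        (h (i + 1) - tan α ^ 2) * hu.recurrence i -
        2 * u (i + 1) * tan_sq_mul_one_add_cos_two_mul hc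
  have hend := hcasoratian (l - 1) (Nat.sub_lt hb.pos one_pos)
  rw [Nat.sub_one_add_one hb.pos.ne', hb.right, hu.right, hu.left] at hend
  linear_combination -hend

theorem sum_mul (hb : IsBlock α l h) (hc : cos α ≠ 0) :
    (∑ i ∈ Finset.range l, (h i - tan α ^ 2)) * (2 * (1 + cos (2 * α))) =
      h 1 + h (l - 1) - 2 * (1 - cos (2 * α)) := by
  have hpartial : ∀ m < l, (∑ i ∈ Finset.range (m + 1), (h i - tan α ^ 2)) *
      (2 * (1 + cos (2 * α))) = h 1 + h m - h (m + 1) - 2 * (1 - cos (2 * α)) := by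
    intro m hm
    induction m with
    | zero =>
      simp only [zero_add, Finset.sum_range_one, hb.left]
      linear_combination -2 * tan_sq_mul_one_add_cos_two_mul hc
    | succ m ih =>
      rw [Finset.sum_range_succ, add_mul, ih (by omega)]
      linear_combination hb.recurrence m hm - 2 * tan_sq_mul_one_add_cos_two_mul hc
  have hend := hpartial (l - 1) (Nat.sub_lt hb.pos one_pos)
  rw [Nat.sub_one_add_one hb.pos.ne', hb.right] at hend
  linarith

theorem sum_mul_of_symm (hb : IsBlock α l h) (hc : cos α ≠ 0) {u : ℕ → ℝ}
    (hu : IsSymmSolution α l u) :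
    (1 + cos (2 * α)) * ((∑ i ∈ Finset.range l, (h i - tan α ^ 2)) * u 0) =
      -tan α ^ 2 * (u 1 + cos (2 * α) * u 0) := by
  linear_combination u 0 / 2 * hb.sum_mul hc + hb.add_mul_of_symm hc hu / 2 +
    u 0 * tan_sq_mul_one_add_cos_two_mul hc

theorem add_two_mul_of_symm (hb : IsBlock α l h) (hc : cos α ≠ 0) (hl : 2 ≤ l) {u : ℕ → ℝ}
    (hu : IsSymmSolution α l u) :
    (h 2 + h (l - 2)) * u 0 = 4 * tan α ^ 2 * (u 0 + cos (2 * α) * u 1) := by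
  have hfirst := hb.recurrence 0 hl
  have hlast := hb.recurrence (l - 2) (by omega)
  rw [show l - 2 + 1 = l - 1 by omega, Nat.sub_add_cancel hl, hb.right] at hlast
  rw [hb.left] at hfirst
  linear_combination u 0 * hfirst + u 0 * hlast -
    2 * cos (2 * α) * hb.add_mul_of_symm hc hu -
    4 * u 0 * tan_sq_mul_one_add_cos_two_mul hc

theorem sum_mul_sin_of_odd (hb : IsBlock α l h) (hc : cos α ≠ 0) (hα : 1 + cos (2 * α) ≠ 0)
    (hl : Odd l) :
    (∑ i ∈ Finset.range l, (h i - tan α ^ 2)) * sin (l * α) = -tan α ^ 3 * cos (l * α) := by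
  have hsum := hb.sum_mul_of_symm hc (isSymmSolution_sin α hl)
  have hsub : ((l : ℝ) - 2) * α = l * α - 2 * α := by ring
  simp only [Nat.cast_zero, Nat.cast_one, mul_zero, mul_one, sub_zero, pow_zero, pow_one, one_mul,
    hsub, sin_sub] at hsum
  apply mul_left_cancel₀ hα
  linear_combination hsum + tan α ^ 2 * cos (l * α) * tan_mul_one_add_cos_two_mul hc

theorem sum_mul_cos_of_even (hb : IsBlock α l h) (hc : cos α ≠ 0) (hα : 1 + cos (2 * α) ≠ 0)
    (hl : Even l) :
    (∑ i ∈ Finset.range l, (h i - tan α ^ 2)) * cos (l * α) = tan α ^ 3 * sin (l * α) := by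
  have hsum := hb.sum_mul_of_symm hc (isSymmSolution_cos α hb.pos hl)
  have hsub : ((l : ℝ) - 2) * α = l * α - 2 * α := by ring
  simp only [Nat.cast_zero, Nat.cast_one, mul_zero, mul_one, sub_zero, pow_zero, pow_one, one_mul,
    hsub, cos_sub] at hsum
  apply mul_left_cancel₀ hα
  linear_combination hsum - tan α ^ 2 * sin (l * α) * tan_mul_one_add_cos_two_mul hc

theorem add_two_mul_sin_of_odd (hb : IsBlock α l h) (hc : cos α ≠ 0) (hl2 : 2 ≤ l) (hl : Odd l) :
    (h 2 + h (l - 2)) * sin (l * α) = 4 * tan α ^ 2 * sin (2 * α) * cos (l * α - 2 * α) := by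
  have hadd := hb.add_two_mul_of_symm hc hl2 (isSymmSolution_sin α hl)
  have hsub : ((l : ℝ) - 2) * α = l * α - 2 * α := by ring
  simp only [Nat.cast_zero, Nat.cast_one, mul_zero, mul_one, sub_zero, pow_zero, pow_one, one_mul,
    hsub] at hadd
  rw [hadd, sin_sub, cos_sub]
  linear_combination -4 * tan α ^ 2 * sin (l * α) * sin_sq_add_cos_sq (2 * α)

theorem add_two_mul_cos_of_even (hb : IsBlock α l h) (hc : cos α ≠ 0) (hl2 : 2 ≤ l)
    (hl : Even l) :
    (h 2 + h (l - 2)) * cos (l * α) = -4 * tan α ^ 2 * sin (2 * α) * sin (l * α - 2 * α) := by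
  have hadd := hb.add_two_mul_of_symm hc hl2 (isSymmSolution_cos α hb.pos hl)
  have hsub : ((l : ℝ) - 2) * α = l * α - 2 * α := by ring
  simp only [Nat.cast_zero, Nat.cast_one, mul_zero, mul_one, sub_zero, pow_zero, pow_one, one_mul,
    hsub] at hadd
  rw [hadd, sin_sub, cos_sub]
  linear_combination -4 * tan α ^ 2 * cos (l * α) * sin_sq_add_cos_sq (2 * α)

theorem add_two_pos (hb : IsBlock α l h) (hl : 3 ≤ l) : 0 < h 2 + h (l - 2) :=
  add_pos (hb.inner 2 two_pos hl) (hb.inner (l - 2) (by omega) (by omega))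

theorem mul_pos_angle (hb : IsBlock α l h) (hα : 0 < α) : 0 < l * α :=
  mul_pos (Nat.cast_pos.2 hb.pos) hα

theorem mul_lt_of_odd (hb : IsBlock α l h) (hα : α ∈ Ioo 0 (π / 4)) (hlα : l * α ≤ π)
    (hl : Odd l) : l * α < π / 2 + 2 * α := by
  have hc := cos_pos_of_lt_pi_div_four hα
  have ht := tan_pos_of_lt_pi_div_four hα
  have hs2 := sin_two_mul_pos_of_lt_pi_div_four hα
  obtain rfl | hl3 : l = 1 ∨ 3 ≤ l := by
    obtain ⟨k, rfl⟩ := hl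
    omega
  · push_cast
    linarith [hα.1, pi_pos]
  have hprod := hb.add_two_mul_sin_of_odd hc.ne' (by omega) hl
  have hfactor : 0 < 4 * tan α ^ 2 * sin (2 * α) := by positivity
  by_contra! hge
  have hlαpos := hb.mul_pos_angle hα.1
  have hcos : cos (l * α - 2 * α) ≤ 0 :=
    cos_nonpos_of_pi_div_two_le_of_le (by linarith) (by linarith [hα.1, pi_pos])
  rcases hlα.lt_or_eq with hlt | heq
  · have hsin := sin_pos_of_pos_of_lt_pi hlαpos hlt
    have hleft := mul_pos (hb.add_two_pos hl3) hsin
    linarith [mul_nonpos_of_nonneg_of_nonpos hfactor.le hcos]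
  · rw [heq, sin_pi, mul_zero, cos_pi_sub, mul_neg] at hprod
    linarith [mul_pos hfactor (cos_two_mul_pos_of_lt_pi_div_four hα)]

theorem sum_of_odd (hb : IsBlock α l h) (hα : α ∈ Ioo 0 (π / 4)) (hlα : l * α ≤ π)
    (hl : Odd l) :
    ∑ i ∈ Finset.range l, (h i - tan α ^ 2) = tan α ^ 3 * tan (l * α - π / 2) := by
  have hc2 := cos_two_mul_pos_of_lt_pi_div_four hα
  have hsin : 0 < sin (l * α) := sin_pos_of_pos_of_lt_pi (hb.mul_pos_angle hα.1)
    (by linarith [hb.mul_lt_of_odd hα hlα hl, hα.2])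
  have hsum := hb.sum_mul_sin_of_odd (cos_pos_of_lt_pi_div_four hα).ne' (by positivity) hl
  rw [tan_sub_pi_div_two, ← mul_div_assoc, eq_div_iff hsin.ne', hsum]
  ring

theorem sum_of_two (hb : IsBlock α 2 h) (hα : α ∈ Ioo 0 (π / 4)) :
    ∑ i ∈ Finset.range 2, (h i - tan α ^ 2) = tan α ^ 3 * tan (2 * α) := by
  have hc2 := cos_two_mul_pos_of_lt_pi_div_four hα
  have hsum := hb.sum_mul_cos_of_even (cos_pos_of_lt_pi_div_four hα).ne' (by positivity) even_two
  push_cast at hsum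
  rw [tan_eq_sin_div_cos (2 * α), ← mul_div_assoc, eq_div_iff hc2.ne', hsum]

theorem sum_nonpos_of_even (hb : IsBlock α l h) (hα : α ∈ Ioo 0 (π / 4)) (hlα : l * α ≤ π)
    (hl : Even l) (hl2 : l ≠ 2) : ∑ i ∈ Finset.range l, (h i - tan α ^ 2) ≤ 0 := by
  have hc := cos_pos_of_lt_pi_div_four hα
  have hc2 := cos_two_mul_pos_of_lt_pi_div_four hα
  have hs2 := sin_two_mul_pos_of_lt_pi_div_four hα
  have ht := tan_pos_of_lt_pi_div_four hα
  have hl4 : 4 ≤ l := by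
    obtain ⟨k, rfl⟩ := hl
    have := hb.pos
    omega
  have hl4' : (4 : ℝ) ≤ l := by exact_mod_cast hl4
  have hsin : 0 < sin (l * α - 2 * α) :=
    sin_pos_of_pos_of_lt_pi (by nlinarith [hα.1]) (by linarith [hα.1])
  have hprod := hb.add_two_mul_cos_of_even hc.ne' (by omega) hl
  have hcos : cos (l * α) < 0 := by
    have hright : 0 < 4 * tan α ^ 2 * sin (2 * α) * sin (l * α - 2 * α) := by positivity
    exact neg_of_mul_neg_right (by linarith) (hb.add_two_pos (by omega)).le
  have hsum := hb.sum_mul_cos_of_even hc.ne' (by positivity) hl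
  have hnonneg : 0 ≤ tan α ^ 3 * sin (l * α) :=
    mul_nonneg (by positivity) (sin_nonneg_of_nonneg_of_le_pi (hb.mul_pos_angle hα.1).le hlα)
  exact nonpos_of_mul_nonneg_left (hsum ▸ hnonneg) hcos

theorem tan_lt_of_odd (hb : IsBlock α l h) (hα : α ∈ Ioo 0 (π / 4)) (hlα : l * α ≤ π)
    (hl : Odd l) : tan (l * α - π / 2) < l / 2 * tan (2 * α) := by
  have ht2 := tan_two_mul_pos_of_lt_pi_div_four hα
  have hlpos := hb.mul_pos_angle hα.1
  obtain rfl | hl3 : l = 1 ∨ 3 ≤ l := by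
    obtain ⟨k, rfl⟩ := hl
    omega
  · push_cast
    have hneg : tan (1 * α - π / 2) < 0 :=
      tan_neg_of_neg_of_pi_div_two_lt (by linarith [hα.2, pi_pos]) (by linarith [hα.1])
    linarith
  · have hlt : tan (l * α - π / 2) < tan (2 * α) := tan_lt_tan_of_lt_of_lt_pi_div_two
      (by linarith) (by linarith [hα.2]) (by linarith [hb.mul_lt_of_odd hα hlα hl])
    have hl3' : (3 : ℝ) ≤ l := by exact_mod_cast hl3
    nlinarith

theorem sum_lt (hb : IsBlock α l h) (hα : α ∈ Ioo 0 (π / 4)) (hlα : l * α ≤ π) (hl2 : l ≠ 2) :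
    ∑ i ∈ Finset.range l, (h i - tan α ^ 2) < tan α ^ 3 * (l / 2 * tan (2 * α)) := by
  have ht := tan_pos_of_lt_pi_div_four hα
  have ht2 := tan_two_mul_pos_of_lt_pi_div_four hα
  have hl0 : (0 : ℝ) < l := Nat.cast_pos.2 hb.pos
  rcases Nat.even_or_odd l with heven | hodd
  · exact (hb.sum_nonpos_of_even hα hlα heven hl2).trans_lt (by positivity)
  · rw [hb.sum_of_odd hα hlα hodd]
    exact mul_lt_mul_of_pos_left (hb.tan_lt_of_odd hα hlα hodd) (by positivity)

end IsBlock

end Blocks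

section Gaps

theorem exists_first_pos {P : ℕ → Prop} {m : ℕ} (hm : 0 < m) (hP : P m) :
    ∃ l, 0 < l ∧ l ≤ m ∧ P l ∧ ∀ i, 0 < i → i < l → ¬P i := by
  classical
  have hex : ∃ l, 0 < l ∧ P l := ⟨m, hm, hP⟩
  exact ⟨Nat.find hex, (Nat.find_spec hex).1, Nat.find_min' hex ⟨hm, hP⟩,
    (Nat.find_spec hex).2, fun i hi hil hPi => Nat.find_min hex hil ⟨hi, hPi⟩⟩

theorem exists_odd_gap {m : ℕ} {P : ℕ → Prop} (hm : Odd m) (h0 : P 0) (hPm : P m) :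
    ∃ a l, a + l ≤ m ∧ Odd l ∧ P a ∧ P (a + l) ∧ ∀ i, 0 < i → i < l → ¬P (a + i) := by
  induction m using Nat.strong_induction_on generalizing P with
  | _ m ih =>
    obtain ⟨l, hl, hlm, hPl, hinner⟩ := exists_first_pos hm.pos hPm
    rcases Nat.even_or_odd l with heven | hodd
    · obtain ⟨a, l', hle, hodd, hPa, hPal, hinner'⟩ := ih (m - l) (by omega)
        (P := fun i => P (l + i)) (Nat.Odd.sub_even hlm hm heven) hPl
        (by rwa [Nat.add_sub_cancel' hlm])
      simp only [← add_assoc] at hPal hinner'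
      exact ⟨l + a, l', by omega, hodd, hPa, hPal, hinner'⟩
    · exact ⟨0, l, by omega, hodd, h0, by rwa [zero_add], by simpa only [zero_add] using hinner⟩

theorem sum_zmod_eq_sum_range {n : ℕ} [NeZero n] {M : Type*} [AddCommMonoid M] (f : ZMod n → M)
    (a : ZMod n) : ∑ i, f i = ∑ k ∈ Finset.range n, f (a + (k : ZMod n)) := by
  refine (Finset.sum_nbij (fun k : ℕ => a + (k : ZMod n)) (by simp) ?_ ?_ (by simp)).symm
  · intro j hj k hk h
    rw [Finset.coe_range, mem_Iio] at hj hk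
    have hmod := (ZMod.natCast_eq_natCast_iff' j k n).1 (add_left_cancel h)
    rwa [Nat.mod_eq_of_lt hj, Nat.mod_eq_of_lt hk] at hmod
  · intro i _
    exact ⟨(i - a).val, by simp [ZMod.val_lt], by simp⟩

end Gaps

section GapValue

variable {n : ℕ} {α : ℝ}

/-- The total of `h - tan α ^ 2`, in units of `tan α ^ 3`, over `n` excesses `h` forming one gap of
odd length `m` and otherwise gaps of length two. For `m = 0` the first term is `tan (-π / 2) = 0`,
so that this is also the total for gaps of length two only. -/
def gapValue (α : ℝ) (n m : ℕ) : ℝ :=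
  tan (m * α - π / 2) + ((n : ℝ) - m) / 2 * tan (2 * α)

theorem gapValue_zero (α : ℝ) (n : ℕ) : gapValue α n 0 = n / 2 * tan (2 * α) := by
  simp [gapValue]

theorem gapValue_add_two_sub (hα : α ∈ Ioo 0 (π / 4)) {m : ℕ} (hm : 0 < m * α)
    (hm2 : m * α + 2 * α < π) :
    gapValue α n (m + 2) - gapValue α n m =
      tan (2 * α) * (tan (m * α - π / 2) * tan (m * α - π / 2 + 2 * α)) := by
  have hadd := tan_add_sub_tan_sub_tan (a := m * α - π / 2) (b := 2 * α)
    (cos_pos_of_mem_Ioo ⟨by linarith, by linarith [hα.1]⟩).ne'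
    (cos_two_mul_pos_of_lt_pi_div_four hα).ne'
    (cos_pos_of_mem_Ioo ⟨by linarith [hα.1], by linarith⟩).ne'
  have hshift : ((m + 2 : ℕ) : ℝ) * α - π / 2 = m * α - π / 2 + 2 * α := by
    push_cast
    ring
  rw [gapValue, gapValue, hshift]
  push_cast
  linear_combination hadd

theorem gapValue_lt_add_two (hα : α ∈ Ioo 0 (π / 4)) (hn : n * α = π) {m : ℕ} (hm : 0 < m)
    (hmn : 2 * (m + 2) < n) : gapValue α n m < gapValue α n (m + 2) := by
  have hmα : 0 < m * α := mul_pos (Nat.cast_pos.2 hm) hα.1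
  have hmn' : 2 * (m * α) + 4 * α < π := by
    have hcast : (2 * (m + 2) : ℝ) < n := by exact_mod_cast hmn
    nlinarith [hα.1]
  rw [← sub_pos, gapValue_add_two_sub hα hmα (by linarith [pi_pos])]
  exact mul_pos (tan_two_mul_pos_of_lt_pi_div_four hα) <| mul_pos_of_neg_of_neg
    (tan_neg_of_neg_of_pi_div_two_lt (by linarith [hα.1]) (by linarith))
    (tan_neg_of_neg_of_pi_div_two_lt (by linarith) (by linarith [hα.1]))

theorem gapValue_add_two_lt (hα : α ∈ Ioo 0 (π / 4)) (hn : n * α = π) {m : ℕ} (hm : 0 < m)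
    (hmn : 2 * m < n) (hnm : n < 2 * m + 4) : gapValue α n (m + 2) < gapValue α n m := by
  have hmα : 0 < m * α := mul_pos (Nat.cast_pos.2 hm) hα.1
  have hmn' : 2 * (m * α) < π := by
    have hcast : 2 * (m : ℝ) < n := by exact_mod_cast hmn
    nlinarith [hα.1]
  have hnm' : π < 2 * (m * α) + 4 * α := by
    have hcast : (n : ℝ) < 2 * m + 4 := by exact_mod_cast hnm
    nlinarith [hα.1]
  rw [← sub_neg, gapValue_add_two_sub hα hmα (by linarith [hα.2])]
  exact mul_neg_of_pos_of_neg (tan_two_mul_pos_of_lt_pi_div_four hα) <| mul_neg_of_neg_of_pos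
    (tan_neg_of_neg_of_pi_div_two_lt (by linarith) (by linarith))
    (tan_pos_of_pos_of_lt_pi_div_two (by linarith) (by linarith [hα.2]))

theorem gapValue_lt_add_two_mul (hα : α ∈ Ioo 0 (π / 4)) (hn : n * α = π) {m : ℕ} (hm : 0 < m)
    (k : ℕ) (hmn : 2 * (m + 2 * (k + 1)) < n) :
    gapValue α n m < gapValue α n (m + 2 * (k + 1)) := by
  induction k with
  | zero => exact gapValue_lt_add_two hα hn hm hmn
  | succ k ih =>
    exact (ih (by omega)).trans (gapValue_lt_add_two hα hn (by omega) (by omega))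

theorem gapValue_lt (hα : α ∈ Ioo 0 (π / 4)) (hn : n * α = π) {l m : ℕ} (hl : Odd l)
    (hm : Odd m) (hmn : 2 * m < n) (hnm : n < 2 * m + 4) (hln : 2 * l < n + 4) (hlm : l ≠ m) :
    gapValue α n l < gapValue α n m := by
  obtain ⟨a, rfl⟩ := hl
  obtain ⟨b, rfl⟩ := hm
  rcases lt_or_gt_of_ne hlm with hlt | hgt
  · obtain ⟨k, rfl⟩ : ∃ k, b = a + (k + 1) := ⟨b - a - 1, by omega⟩
    rw [show 2 * (a + (k + 1)) + 1 = 2 * a + 1 + 2 * (k + 1) by ring] at hmn ⊢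
    exact gapValue_lt_add_two_mul hα hn (by omega) k hmn
  · obtain rfl : a = b + 1 := by omega
    exact gapValue_add_two_lt hα hn (by omega) hmn hnm

theorem gapValue_pos (hα : α ∈ Ioo 0 (π / 4)) (hn : n * α = π) {m : ℕ} (hm : 0 < m)
    (hmn : 2 * m < n) (hnm : n < 2 * m + 4) : 0 < gapValue α n m := by
  refine lt_of_le_of_lt ?_ (gapValue_add_two_lt hα hn hm hmn hnm)
  have hmn' : 2 * (m * α) < π := by
    have hcast : 2 * (m : ℝ) < n := by exact_mod_cast hmn
    nlinarith [hα.1]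
  have hnm' : π < 2 * (m * α) + 4 * α := by
    have hcast : (n : ℝ) < 2 * m + 4 := by exact_mod_cast hnm
    nlinarith [hα.1]
  have hlen : ((m + 2 : ℕ) : ℝ) ≤ n := by
    have hn4 : (4 : ℝ) < n := by nlinarith [hα.1, hα.2]
    have hn4' : 4 < n := by exact_mod_cast hn4
    exact_mod_cast (by omega : m + 2 ≤ n)
  refine add_nonneg (tan_pos_of_pos_of_lt_pi_div_two ?_ ?_).le
    (mul_nonneg (by linarith) (tan_two_mul_pos_of_lt_pi_div_four hα).le) <;>
  · push_cast
    linarith [hα.2]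

end GapValue

section ExcessSequences

/-- The side `j` is used in the pattern consisting of a gap of length `m` followed by gaps of
length two; for `m = 0` every second side is used. -/
def IsUsed (m j : ℕ) : Prop := j = 0 ∨ m ≤ j ∧ Even (j - m)

theorem isUsed_zero_iff (j : ℕ) : IsUsed 0 j ↔ Even j := by
  simp +contextual [IsUsed]

/-- A nonnegative family of excesses, indexed by `ℕ` or cyclically by `ZMod n`, that satisfies the
recurrence of optimal polygons wherever it is positive. -/
structure IsExcessSeq {ι : Type*} [Add ι] [One ι] (α : ℝ) (h : ι → ℝ) : Prop where
  nonneg : ∀ i, 0 ≤ h i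
  recurrence : ∀ i, 0 < h (i + 1) →
    h i + 2 * cos (2 * α) * h (i + 1) + h (i + 1 + 1) = 2 * (1 - cos (2 * α))

namespace IsExcessSeq

variable {α : ℝ}

theorem comp_add_natCast {ι : Type*} [AddMonoidWithOne ι] {h : ι → ℝ} (hh : IsExcessSeq α h)
    (a : ι) : IsExcessSeq α fun k : ℕ => h (a + k) where
  nonneg _ := hh.nonneg _
  recurrence k hk := by
    push_cast at hk ⊢
    simp only [← add_assoc] at hk ⊢
    exact hh.recurrence (a + k) hk

theorem comp_add_left {H : ℕ → ℝ} (hH : IsExcessSeq α H) (a : ℕ) :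
    IsExcessSeq α fun k => H (a + k) := by
  simpa only [Nat.cast_id] using hH.comp_add_natCast a

theorem isBlock {H : ℕ → ℝ} (hH : IsExcessSeq α H) {l : ℕ} (hl : 0 < l) (h0 : H 0 = 0)
    (hHl : H l = 0) (hinner : ∀ i, 0 < i → i < l → H i ≠ 0) : IsBlock α l H where
  pos := hl
  left := h0
  right := hHl
  inner i hi hil := (hH.nonneg i).lt_of_ne (hinner i hi hil).symm
  recurrence i hi := hH.recurrence i ((hH.nonneg _).lt_of_ne (hinner (i + 1) i.succ_pos hi).symm)

theorem sum_le {m : ℕ} (hα : α ∈ Ioo 0 (π / 4)) {H : ℕ → ℝ} (hH : IsExcessSeq α H)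
    (hm : m * α ≤ π) (h0 : H 0 = 0) (hHm : H m = 0) :
    ∑ i ∈ Finset.range m, (H i - tan α ^ 2) ≤ tan α ^ 3 * (m / 2 * tan (2 * α)) ∧
    (∑ i ∈ Finset.range m, (H i - tan α ^ 2) = tan α ^ 3 * (m / 2 * tan (2 * α)) →
      ∀ j < m, H j = 0 ↔ Even j) := by
  induction m using Nat.strong_induction_on generalizing H with
  | _ m ih =>
    rcases m.eq_zero_or_pos with rfl | hm0
    · simp
    obtain ⟨l, hl, hlm, hHl, hinner⟩ := exists_first_pos (P := fun i => H i = 0) hm0 hHm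
    have hblock := hH.isBlock hl h0 hHl hinner
    have hcast : ((m - l : ℕ) : ℝ) = m - l := Nat.cast_sub hlm
    have hlα : l * α ≤ π :=
      (mul_le_mul_of_nonneg_right (Nat.cast_le.2 hlm) hα.1.le).trans hm
    obtain ⟨hle, heq⟩ := ih (m - l) (by omega) (hH.comp_add_left l)
      (by rw [hcast]; linarith [hblock.mul_pos_angle hα.1])
      hHl (by rwa [Nat.add_sub_cancel' hlm])
    have hsplit : ∑ i ∈ Finset.range m, (H i - tan α ^ 2) =
        ∑ i ∈ Finset.range l, (H i - tan α ^ 2) +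
        ∑ i ∈ Finset.range (m - l), (H (l + i) - tan α ^ 2) := by
      rw [← Finset.sum_range_add, Nat.add_sub_cancel' hlm]
    have hbound : tan α ^ 3 * (m / 2 * tan (2 * α)) = tan α ^ 3 * (l / 2 * tan (2 * α)) +
        tan α ^ 3 * ((m - l) / 2 * tan (2 * α)) := by ring
    rw [hcast] at hle heq
    rw [hsplit, hbound]
    rcases eq_or_ne l 2 with rfl | hl2
    · have htwo := hblock.sum_of_two hα
      push_cast at heq hle ⊢
      refine ⟨by linarith, fun hsum j hj => ?_⟩
      match j with
      | 0 => simp [h0]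
      | 1 => simpa using hinner 1 one_pos one_lt_two
      | j + 2 => simpa [add_comm 2 j, Nat.even_add] using heq (by linarith) j (by omega)
    · have hlt := hblock.sum_lt hα hlα hl2
      exact ⟨by linarith, fun hsum => by linarith⟩

theorem sum_le_of_odd_gap {n l : ℕ} (hα : α ∈ Ioo 0 (π / 4)) (hn : n * α = π) {H : ℕ → ℝ}
    (hH : IsExcessSeq α H) (hl : Odd l) (hln : l ≤ n) (h0 : H 0 = 0) (hHl : H l = 0)
    (hHn : H n = 0) (hinner : ∀ i, 0 < i → i < l → H i ≠ 0) :
    ∑ i ∈ Finset.range n, (H i - tan α ^ 2) ≤ tan α ^ 3 * gapValue α n l ∧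
    (∑ i ∈ Finset.range n, (H i - tan α ^ 2) = tan α ^ 3 * gapValue α n l →
      ∀ j < n, H j = 0 ↔ IsUsed l j) := by
  have hcast : ((n - l : ℕ) : ℝ) = n - l := Nat.cast_sub hln
  have hblock := hH.isBlock hl.pos h0 hHl hinner
  have hlpos := hblock.mul_pos_angle hα.1
  have hlα : l * α ≤ π := hn ▸ mul_le_mul_of_nonneg_right (Nat.cast_le.2 hln) hα.1.le
  obtain ⟨hle, heq⟩ := (hH.comp_add_left l).sum_le (m := n - l) hα (by rw [hcast]; linarith) hHl
    (by rwa [Nat.add_sub_cancel' hln])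
  have hsplit : ∑ i ∈ Finset.range n, (H i - tan α ^ 2) = tan α ^ 3 * tan (l * α - π / 2) +
      ∑ i ∈ Finset.range (n - l), (H (l + i) - tan α ^ 2) := by
    rw [← hblock.sum_of_odd hα hlα hl, ← Finset.sum_range_add, Nat.add_sub_cancel' hln]
  rw [hcast] at hle heq
  rw [hsplit, gapValue, mul_add]
  refine ⟨by linarith, fun hsum j hj => ?_⟩
  have htail := heq (by linarith)
  rcases lt_or_ge j l with hjl | hjl
  · rcases j.eq_zero_or_pos with rfl | hj0
    · simp [h0, IsUsed]
    · simp [hinner j hj0 hjl, IsUsed, hj0.ne', hjl]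
  · have hj0 : j ≠ 0 := (hl.pos.trans_le hjl).ne'
    simpa [Nat.add_sub_cancel' hjl, IsUsed, hj0, hjl] using htail (j - l) (by omega)

end IsExcessSeq

end ExcessSequences

section Cyclic

/-- `m` is the length of the exceptional gap of the optimal polygons: there is none (`m = 0`) for
even `n`, and `m` is the largest odd number below `n / 2` for odd `n`. -/
def IsOptimalGap (n m : ℕ) : Prop :=
  Even n ∧ m = 0 ∨ Odd n ∧ Odd m ∧ 2 * m < n ∧ n < 2 * m + 4

namespace IsExcessSeq

variable {n : ℕ} [NeZero n] {α : ℝ} {h : ZMod n → ℝ}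

theorem sum_eq_zero_of_forall_pos (hh : IsExcessSeq α h) (hc : cos α ≠ 0)
    (hpos : ∀ i, 0 < h i) : ∑ i, (h i - tan α ^ 2) = 0 := by
  have hrec : ∑ i, (h i + 2 * cos (2 * α) * h (i + 1) + h (i + 1 + 1)) =
      ∑ _i : ZMod n, 2 * (1 - cos (2 * α)) :=
    Finset.sum_congr rfl fun i _ => hh.recurrence i (hpos _)
  have hshift : ∀ f : ZMod n → ℝ, ∑ i, f (i + 1) = ∑ i, f i :=
    Equiv.sum_comp (Equiv.addRight (1 : ZMod n))
  rw [Finset.sum_add_distrib, Finset.sum_add_distrib, ← Finset.mul_sum,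
    hshift fun i => h (i + 1), hshift] at hrec
  have hc2 : 1 + cos (2 * α) ≠ 0 := by
    rw [cos_two_mul]
    simpa using hc
  apply mul_right_cancel₀ hc2
  rw [Finset.sum_sub_distrib]
  simp only [Finset.sum_const, Finset.card_univ, ZMod.card, nsmul_eq_mul] at hrec ⊢
  linear_combination hrec / 2 - n * tan_sq_mul_one_add_cos_two_mul hc

theorem sum_le_of_exists_zero (hh : IsExcessSeq α h) (hα : α ∈ Ioo 0 (π / 4)) (hn : n * α = π)
    (hzero : ∃ a, h a = 0) {m : ℕ} (hm : IsOptimalGap n m) :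
    ∑ i, (h i - tan α ^ 2) ≤ tan α ^ 3 * gapValue α n m ∧
    (∑ i, (h i - tan α ^ 2) = tan α ^ 3 * gapValue α n m →
      ∃ a : ZMod n, ∀ j < n, h (a + (j : ZMod n)) = 0 ↔ IsUsed m j) := by
  obtain ⟨b, hb⟩ := hzero
  rcases hm with ⟨-, rfl⟩ | ⟨hnodd, hmodd, hmn, hnm⟩
  · obtain ⟨hle, heq⟩ := (hh.comp_add_natCast b).sum_le (m := n) hα hn.le (by simpa) (by simpa)
    simp only [gapValue_zero, isUsed_zero_iff, sum_zmod_eq_sum_range _ b]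
    exact ⟨hle, fun hsum => ⟨b, heq hsum⟩⟩
  obtain ⟨k, l, hkl, hl, hk, hkl0, hinner⟩ := exists_odd_gap
    (P := fun j : ℕ => h (b + j) = 0) hnodd (by simpa) (by simpa)
  simp only [Nat.cast_add, ← add_assoc] at hkl0 hinner
  generalize b + (k : ZMod n) = a at hk hkl0 hinner
  have hseq := hh.comp_add_natCast a
  have hln : l ≤ n := by omega
  obtain ⟨hle, heq⟩ := hseq.sum_le_of_odd_gap hα hn hl hln (by simpa) hkl0 (by simpa) hinner
  rw [sum_zmod_eq_sum_range _ a]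
  rcases eq_or_ne l m with rfl | hlm
  · exact ⟨hle, fun hsum => ⟨a, heq hsum⟩⟩
  · have hblock := hseq.isBlock hl.pos (by simpa) hkl0 hinner
    have hlα : l * α ≤ π := hn ▸ mul_le_mul_of_nonneg_right (Nat.cast_le.2 hln) hα.1.le
    have hshort : 2 * l < n + 4 := by
      have hcast : 2 * (l : ℝ) < n + 4 := by
        nlinarith [hblock.mul_lt_of_odd hα hlα hl, hα.1]
      exact_mod_cast hcast
    have hlt := mul_lt_mul_of_pos_left (gapValue_lt hα hn hl hmodd hmn hnm hshort hlm)
      (pow_pos (tan_pos_of_lt_pi_div_four hα) 3)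
    exact ⟨by linarith, fun hsum => by linarith⟩

theorem sum_le_gapValue (hh : IsExcessSeq α h) (hα : α ∈ Ioo 0 (π / 4)) (hn : n * α = π) {m : ℕ}
    (hm : IsOptimalGap n m) :
    ∑ i, (h i - tan α ^ 2) ≤ tan α ^ 3 * gapValue α n m ∧
    (∑ i, (h i - tan α ^ 2) = tan α ^ 3 * gapValue α n m →
      ∃ a : ZMod n, ∀ j < n, h (a + (j : ZMod n)) = 0 ↔ IsUsed m j) := by
  by_cases hzero : ∃ a, h a = 0
  · exact hh.sum_le_of_exists_zero hα hn hzero hm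
  push Not at hzero
  have hvalue : 0 < gapValue α n m := by
    rcases hm with ⟨-, rfl⟩ | ⟨-, hmodd, hmn, hnm⟩
    · rw [gapValue_zero]
      have hn0 : (0 : ℝ) < n := Nat.cast_pos.2 (NeZero.pos n)
      have ht2 := tan_two_mul_pos_of_lt_pi_div_four hα
      positivity
    · exact gapValue_pos hα hn hmodd.pos hmn hnm
  have hpos := mul_pos (pow_pos (tan_pos_of_lt_pi_div_four hα) 3) hvalue
  rw [hh.sum_eq_zero_of_forall_pos (cos_pos_of_lt_pi_div_four hα).ne'
    fun i => (hh.nonneg i).lt_of_ne (hzero i).symm]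
  exact ⟨hpos.le, fun hsum => absurd hsum hpos.ne⟩

end IsExcessSeq

end Cyclic

section ExtremalSequence

variable {α : ℝ} {m n : ℕ}

/-- The block of odd length `m`, obtained by adding to the constant solution `tan α ^ 2` of the
recurrence the multiple of a symmetric homogeneous solution that makes the ends vanish. -/
def oddBlock (α : ℝ) (m k : ℕ) : ℝ :=
  tan α ^ 2 * (1 - (-1) ^ k * sin ((m - 2 * k) * α) / sin (m * α))

theorem neg_one_pow_mul_sin_lt_sin (hα : 0 < α) (hmα : m * α < π / 2) {k : ℕ} (hk0 : 0 < k)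
    (hkm : k < m) : (-1) ^ k * sin ((m - 2 * k) * α) < sin (m * α) := by
  have hk0α : 0 < k * α := mul_pos (Nat.cast_pos.2 hk0) hα
  have hkmα : k * α < m * α := mul_lt_mul_of_pos_right (Nat.cast_lt.2 hkm) hα
  have habs : |sin ((m - 2 * k) * α)| < sin (m * α) := by
    rw [abs_lt, ← sin_neg]
    constructor <;> refine strictMonoOn_sin ⟨?_, ?_⟩ ⟨?_, ?_⟩ ?_ <;> linarith
  calc (-1) ^ k * sin ((m - 2 * k) * α)
      ≤ |(-1) ^ k * sin ((m - 2 * k) * α)| := le_abs_self _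
    _ = |sin ((m - 2 * k) * α)| := by rw [abs_mul, abs_neg_one_pow, one_mul]
    _ < sin (m * α) := habs

theorem isBlock_oddBlock (hα : α ∈ Ioo 0 (π / 4)) (hm : Odd m) (hmα : m * α < π / 2) :
    IsBlock α m (oddBlock α m) := by
  have hsymm := isSymmSolution_sin α hm
  have hsin : 0 < sin (m * α) :=
    sin_pos_of_pos_of_lt_pi (mul_pos (Nat.cast_pos.2 hm.pos) hα.1) (by linarith [pi_pos])
  have hleft : oddBlock α m 0 = 0 := by
    simp [oddBlock, hsin.ne']
  refine ⟨hm.pos, hleft, ?_, fun k hk0 hkm => ?_, fun k _ => ?_⟩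
  · rw [← hleft, oddBlock, oddBlock, hsymm.right]
  · refine mul_pos (pow_pos (tan_pos_of_lt_pi_div_four hα) 2) (sub_pos.2 ?_)
    exact (div_lt_one hsin).2 (neg_one_pow_mul_sin_lt_sin hα.1 hmα hk0 hkm)
  · unfold oddBlock
    linear_combination 2 * tan_sq_mul_one_add_cos_two_mul (cos_pos_of_lt_pi_div_four hα).ne' -
      tan α ^ 2 / sin (m * α) * hsymm.recurrence k

/-- The excesses in a run of gaps of length two. -/
def twoGapSeq (α : ℝ) (k : ℕ) : ℝ :=
  if Even k then 0 else (1 - cos (2 * α)) / cos (2 * α)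

theorem one_sub_cos_two_mul_pos (hα : α ∈ Ioo 0 (π / 4)) : 0 < 1 - cos (2 * α) := by
  rw [← tan_sq_mul_one_add_cos_two_mul (cos_pos_of_lt_pi_div_four hα).ne']
  exact mul_pos (pow_pos (tan_pos_of_lt_pi_div_four hα) 2)
    (by linarith [cos_two_mul_pos_of_lt_pi_div_four hα])

theorem isExcessSeq_twoGapSeq (hα : α ∈ Ioo 0 (π / 4)) : IsExcessSeq α (twoGapSeq α) where
  nonneg k := by
    unfold twoGapSeq
    split_ifs
    · exact le_rfl
    · exact (div_pos (one_sub_cos_two_mul_pos hα) (cos_two_mul_pos_of_lt_pi_div_four hα)).le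
  recurrence k hk := by
    have hc := (cos_two_mul_pos_of_lt_pi_div_four hα).ne'
    rcases Nat.even_or_odd k with heven | hodd
    · simp only [twoGapSeq, heven, Nat.even_add_one, not_true, not_false_iff, if_true, if_false]
      field_simp
      ring
    · simp [twoGapSeq, hodd.add_one] at hk

theorem twoGapSeq_eq_zero_iff (hα : α ∈ Ioo 0 (π / 4)) (k : ℕ) : twoGapSeq α k = 0 ↔ Even k := by
  have hpos := div_pos (one_sub_cos_two_mul_pos hα) (cos_two_mul_pos_of_lt_pi_div_four hα)
  simp only [twoGapSeq, ite_eq_left_iff, hpos.ne', imp_false, not_not]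

theorem sum_twoGapSeq (hα : α ∈ Ioo 0 (π / 4)) (q : ℕ) :
    ∑ i ∈ Finset.range (2 * q), (twoGapSeq α i - tan α ^ 2) =
      tan α ^ 3 * (q * tan (2 * α)) := by
  have hblock : IsBlock α 2 (twoGapSeq α) :=
    (isExcessSeq_twoGapSeq hα).isBlock two_pos (by simp [twoGapSeq]) (by simp [twoGapSeq])
      fun i hi hi2 => by
        obtain rfl : i = 1 := by omega
        simp [twoGapSeq_eq_zero_iff hα]
  induction q with
  | zero => simp
  | succ q ih =>
    have hperiod : ∀ i, twoGapSeq α (2 * q + i) = twoGapSeq α i := by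
      simp [twoGapSeq, Nat.even_add]
    simp only [mul_add_one, Finset.sum_range_add, ih, hperiod, hblock.sum_of_two hα]
    push_cast
    ring

/-- The excesses of the extremal polygons: a gap of length `m` followed by gaps of length two. -/
def extremalSeq (α : ℝ) (m k : ℕ) : ℝ :=
  if k < m then oddBlock α m k else twoGapSeq α (k - m)

theorem extremalSeq_zero (α : ℝ) : extremalSeq α 0 = twoGapSeq α := by
  ext k
  simp [extremalSeq]

theorem extremalSeq_of_lt {k : ℕ} (hk : k < m) : extremalSeq α m k = oddBlock α m k :=
  if_pos hk

theorem extremalSeq_add (α : ℝ) (m k : ℕ) : extremalSeq α m (m + k) = twoGapSeq α k := by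
  simp [extremalSeq]

theorem isBlock_extremalSeq (hα : α ∈ Ioo 0 (π / 4)) (hm : Odd m) (hmα : m * α < π / 2) :
    IsBlock α m (extremalSeq α m) := by
  have hblock := isBlock_oddBlock hα hm hmα
  have heq : ∀ k ≤ m, extremalSeq α m k = oddBlock α m k := by
    intro k hk
    rcases hk.lt_or_eq with hlt | rfl
    · exact extremalSeq_of_lt hlt
    · simp [extremalSeq, twoGapSeq, hblock.right]
  refine ⟨hm.pos, ?_, ?_, fun k hk hkm => ?_, fun k hk => ?_⟩
  · rw [heq 0 (Nat.zero_le m), hblock.left]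
  · rw [heq m le_rfl, hblock.right]
  · rw [heq k hkm.le]
    exact hblock.inner k hk hkm
  · rw [heq k (by omega), heq (k + 1) hk.le, heq (k + 2) hk, hblock.recurrence k hk]

theorem isExcessSeq_extremalSeq (hα : α ∈ Ioo 0 (π / 4)) (hm : m = 0 ∨ Odd m)
    (hmα : m * α < π / 2) : IsExcessSeq α (extremalSeq α m) := by
  have htwo := isExcessSeq_twoGapSeq hα
  rcases hm with rfl | hm
  · rwa [extremalSeq_zero]
  have hblock := isBlock_extremalSeq hα hm hmα
  refine ⟨fun k => ?_, fun k hk => ?_⟩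
  · rcases lt_or_ge k m with hkm | hmk
    · rcases k.eq_zero_or_pos with rfl | hk0
      · exact hblock.left.ge
      · exact (hblock.inner k hk0 hkm).le
    · obtain ⟨j, rfl⟩ := Nat.exists_eq_add_of_le hmk
      rw [extremalSeq_add]
      exact htwo.nonneg j
  · rcases lt_trichotomy (k + 1) m with hkm | rfl | hmk
    · exact hblock.recurrence k hkm
    · exact absurd hblock.right hk.ne'
    · obtain ⟨j, rfl⟩ := Nat.exists_eq_add_of_le (Nat.lt_succ_iff.1 hmk)
      simp only [add_assoc m, extremalSeq_add] at hk ⊢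
      exact htwo.recurrence j hk

theorem extremalSeq_eq_zero_iff (hα : α ∈ Ioo 0 (π / 4)) (hm : m = 0 ∨ Odd m)
    (hmα : m * α < π / 2) (k : ℕ) : extremalSeq α m k = 0 ↔ IsUsed m k := by
  rcases hm with rfl | hm
  · rw [extremalSeq_zero, twoGapSeq_eq_zero_iff hα, isUsed_zero_iff]
  have hblock := isBlock_extremalSeq hα hm hmα
  rcases lt_or_ge k m with hkm | hmk
  · rcases k.eq_zero_or_pos with rfl | hk0
    · simp [hblock.left, IsUsed]
    · simp [(hblock.inner k hk0 hkm).ne', IsUsed, hk0.ne', hkm]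
  · obtain ⟨j, rfl⟩ := Nat.exists_eq_add_of_le hmk
    simp [extremalSeq_add, twoGapSeq_eq_zero_iff hα, IsUsed, hm.pos.ne']

theorem sum_extremalSeq (hα : α ∈ Ioo 0 (π / 4)) (hm : m = 0 ∨ Odd m) (hmα : m * α < π / 2)
    (hmn : m ≤ n) (heven : Even (n - m)) :
    ∑ i ∈ Finset.range n, (extremalSeq α m i - tan α ^ 2) = tan α ^ 3 * gapValue α n m := by
  obtain ⟨q, hq⟩ := heven.two_dvd
  obtain rfl : n = m + 2 * q := by omega
  simp only [Finset.sum_range_add, extremalSeq_add, sum_twoGapSeq hα]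
  rcases hm with rfl | hm
  · simp [gapValue_zero]
  · rw [(isBlock_extremalSeq hα hm hmα).sum_of_odd hα (by linarith [pi_pos]) hm, gapValue]
    push_cast
    ring

theorem IsOptimalGap.eq_zero_or_odd (hm : IsOptimalGap n m) : m = 0 ∨ Odd m := by
  rcases hm with ⟨-, hm⟩ | ⟨-, hm, -⟩
  exacts [Or.inl hm, Or.inr hm]

theorem IsOptimalGap.even_sub (hm : IsOptimalGap n m) : Even (n - m) := by
  rcases hm with ⟨hn, rfl⟩ | ⟨hn, hm, -⟩
  exacts [hn, Nat.Odd.sub_odd hn hm]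

theorem IsUsed.not_add_one {k : ℕ} (hk : k ≠ 0) (hused : IsUsed m k) : ¬IsUsed m (k + 1) := by
  simp only [IsUsed, Nat.even_iff] at hused ⊢
  omega

end ExtremalSequence

section Optimum

variable {n : ℕ} [NeZero n] {α : ℝ} {m : ℕ}

theorem val_add_one_of_lt {i : ZMod n} (hi : i.val + 1 < n) : (i + 1).val = i.val + 1 := by
  rw [← ZMod.val_natCast_of_lt hi, Nat.cast_add_one, ZMod.natCast_zmod_val]

theorem apply_val_add_one {H : ℕ → ℝ} (h0 : H 0 = 0) (hn : H n = 0) (i : ZMod n) :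
    H (i + 1).val = H (i.val + 1) := by
  rcases (Nat.add_one_le_of_lt (ZMod.val_lt i)).lt_or_eq with hlt | heq
  · rw [val_add_one_of_lt hlt]
  · have hwrap : i + 1 = 0 := by
      rw [← ZMod.natCast_zmod_val i, ← Nat.cast_add_one, heq, ZMod.natCast_self]
    rw [hwrap, ZMod.val_zero, heq, h0, hn]

theorem IsExcessSeq.comp_val {H : ℕ → ℝ} (hH : IsExcessSeq α H) (h0 : H 0 = 0) (hn : H n = 0) :
    IsExcessSeq α fun i : ZMod n => H i.val where
  nonneg i := hH.nonneg i.val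
  recurrence i hi := by
    rcases (Nat.add_one_le_of_lt (ZMod.val_lt i)).lt_or_eq with hlt | heq
    · rw [apply_val_add_one h0 hn (i + 1)]
      rw [val_add_one_of_lt hlt] at hi ⊢
      exact hH.recurrence i.val hi
    · rw [apply_val_add_one h0 hn, heq, hn] at hi
      exact absurd hi (lt_irrefl 0)

theorem IsOptimalGap.two_mul_lt (hm : IsOptimalGap n m) : 2 * m < n := by
  rcases hm with ⟨-, rfl⟩ | ⟨-, -, hmn, -⟩
  exacts [NeZero.pos n, hmn]

theorem IsOptimalGap.mul_lt_pi_div_two (hm : IsOptimalGap n m) (hα : 0 < α) (hn : n * α = π) :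
    m * α < π / 2 := by
  have hcast : 2 * (m : ℝ) < n := by exact_mod_cast hm.two_mul_lt
  nlinarith

/-- The total excess is at most `V`, which is attained, and only with the sides used in the pattern
`IsUsed m`, up to rotation. -/
structure IsOptimum (n : ℕ) [NeZero n] (M V : ℝ) (m : ℕ) : Prop where
  le : ∀ z ∈ Icc (-1 : ZMod n → ℝ) 1, totalExcess M z ≤ V
  pattern : ∀ z ∈ Icc (-1 : ZMod n → ℝ) 1, totalExcess M z = V →
    ∃ a : ZMod n, ∀ j < n, sideExcess M z (a + (j : ZMod n)) = 0 ↔ IsUsed m j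
  attained : ∃ z ∈ Icc (-1 : ZMod n → ℝ) 1, totalExcess M z = V ∧
    ∀ j < n, sideExcess M z (j : ZMod n) = 0 ↔ IsUsed m j

theorem exists_sideExcess_eq_extremalSeq (hα : α ∈ Ioo 0 (π / 4)) (hn : n * α = π)
    (hm : IsOptimalGap n m) :
    ∃ z ∈ Icc (-1 : ZMod n → ℝ) 1,
      ∀ i, sideExcess (1 - cos (2 * α)) z i = extremalSeq α m i.val := by
  have hmα := hm.mul_lt_pi_div_two hα.1 hn
  have hseq := isExcessSeq_extremalSeq hα hm.eq_zero_or_odd hmα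
  have hused := extremalSeq_eq_zero_iff hα hm.eq_zero_or_odd hmα
  have h0 : extremalSeq α m 0 = 0 := (hused 0).2 (Or.inl rfl)
  have hn0 : extremalSeq α m n = 0 :=
    (hused n).2 (Or.inr ⟨by linarith [hm.two_mul_lt], hm.even_sub⟩)
  have hn2 : 2 < n := by
    have hcast : (2 : ℝ) < n := by nlinarith [hα.1, hα.2]
    exact_mod_cast hcast
  have hcyclic := hseq.comp_val h0 hn0
  refine exists_sideExcess_eq (one_sub_cos_two_mul_pos hα).ne' hcyclic.nonneg (fun i hi => ?_)
    fun i hi => ?_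
  · rw [sub_sub_cancel]
    exact hcyclic.recurrence i hi
  · have hpos : ∀ k, ¬IsUsed m k → 0 < extremalSeq α m k := fun k hk =>
      (hseq.nonneg k).lt_of_ne fun heq => hk ((hused k).1 heq.symm)
    rw [apply_val_add_one h0 hn0 (i + 1)]
    rw [apply_val_add_one h0 hn0, hused] at hi
    rcases (Nat.add_one_le_of_lt (ZMod.val_lt i)).lt_or_eq with hlt | heq
    · rw [val_add_one_of_lt hlt]
      exact Or.inr (hpos _ (hi.not_add_one i.val.succ_ne_zero))
    · exact Or.inl (hpos _ fun hused_i => hused_i.not_add_one (by omega) hi)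

theorem isExcessSeq_sideExcess_of_isMaxOn (hα : α ∈ Ioo 0 (π / 4)) (hn : 2 ≤ n)
    {z : ZMod n → ℝ} (hz : z ∈ Icc (-1) 1)
    (hmax : IsMaxOn (totalExcess (1 - cos (2 * α))) (Icc (-1) 1) z) :
    IsExcessSeq α (sideExcess (1 - cos (2 * α)) z) where
  nonneg := sideExcess_nonneg (one_sub_cos_two_mul_pos hα).le
    (by linarith [cos_two_mul_pos_of_lt_pi_div_four hα]) hz
  recurrence i hi := by
    have hrec := sideExcess_recurrence_of_isMaxOn hn (one_sub_cos_two_mul_pos hα)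
      (by linarith [cos_two_mul_pos_of_lt_pi_div_four hα]) hz hmax i hi
    rwa [sub_sub_cancel] at hrec

theorem isOptimum_of_isOptimalGap (hα : α ∈ Ioo 0 (π / 4)) (hn : n * α = π)
    (hm : IsOptimalGap n m) :
    IsOptimum n (1 - cos (2 * α)) (n * tan α ^ 2 + tan α ^ 3 * gapValue α n m) m := by
  have hn2 : 2 ≤ n := by
    have hcast : (2 : ℝ) ≤ n := by nlinarith [hα.1, hα.2]
    exact_mod_cast hcast
  have htotal : ∀ z : ZMod n → ℝ, ∑ i, (sideExcess (1 - cos (2 * α)) z i - tan α ^ 2) =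
      totalExcess (1 - cos (2 * α)) z - n * tan α ^ 2 := by
    simp [totalExcess]
  have hle : ∀ z ∈ Icc (-1 : ZMod n → ℝ) 1, totalExcess (1 - cos (2 * α)) z ≤
      n * tan α ^ 2 + tan α ^ 3 * gapValue α n m := by
    obtain ⟨z, hz, hmax⟩ := exists_isMaxOn_totalExcess (n := n) (one_sub_cos_two_mul_pos hα).le
      (by linarith [cos_two_mul_pos_of_lt_pi_div_four hα])
    have hbound := ((isExcessSeq_sideExcess_of_isMaxOn hα hn2 hz hmax).sum_le_gapValue hα hn hm).1
    rw [htotal, sub_le_iff_le_add'] at hbound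
    exact fun w hw => (hmax hw).trans hbound
  refine ⟨hle, fun z hz heq => ?_, ?_⟩
  · have hmax : IsMaxOn (totalExcess (1 - cos (2 * α))) (Icc (-1) 1) z :=
      fun w hw => (hle w hw).trans heq.ge
    refine ((isExcessSeq_sideExcess_of_isMaxOn hα hn2 hz hmax).sum_le_gapValue hα hn hm).2 ?_
    rw [htotal, heq, add_sub_cancel_left]
  · have hmα := hm.mul_lt_pi_div_two hα.1 hn
    obtain ⟨z, hz, hsides⟩ := exists_sideExcess_eq_extremalSeq hα hn hm
    have hside : ∀ j < n, sideExcess (1 - cos (2 * α)) z (j : ZMod n) = extremalSeq α m j := by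
      intro j hj
      rw [hsides, ZMod.val_natCast_of_lt hj]
    refine ⟨z, hz, ?_, fun j hj => ?_⟩
    · have hsum := sum_extremalSeq hα hm.eq_zero_or_odd hmα (by linarith [hm.two_mul_lt])
        hm.even_sub
      have hcyclic : ∑ i, (sideExcess (1 - cos (2 * α)) z i - tan α ^ 2) =
          ∑ j ∈ Finset.range n, (extremalSeq α m j - tan α ^ 2) := by
        rw [sum_zmod_eq_sum_range _ 0]
        refine Finset.sum_congr rfl fun j hj => ?_
        rw [zero_add, hside j (Finset.mem_range.1 hj)]
      rw [htotal, hsum] at hcyclic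
      linarith
    · rw [hside j hj]
      exact extremalSeq_eq_zero_iff hα hm.eq_zero_or_odd hmα j

end Optimum

section Support

variable {E : Type*} [NormedAddCommGroup E] [NormedSpace ℝ E] {Q : Set E} {f : E →L[ℝ] ℝ} {x y : E}

theorem mem_frontier_of_isMaxOn (hf : f ≠ 0) (hx : x ∈ Q) (hmax : IsMaxOn f Q x) :
    x ∈ frontier Q :=
  ⟨subset_closure hx, fun hint => hf <|
    (hmax.isLocalMax (mem_interior_iff_mem_nhds.1 hint)).hasFDerivAt_eq_zero f.hasFDerivAt⟩

theorem segment_subset_frontier_of_isMaxOn (hQ : Convex ℝ Q) (hf : f ≠ 0) (hx : x ∈ Q) (hy : y ∈ Q)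
    (hmax_x : IsMaxOn f Q x) (hmax_y : IsMaxOn f Q y) : segment ℝ x y ⊆ frontier Q := by
  intro w hw
  have hxy : f x = f y := le_antisymm (hmax_y hx) (hmax_x hy)
  have hfw : f w = f x := by
    obtain ⟨s, t, -, -, hst, rfl⟩ := hw
    simp only [map_add, map_smul, smul_eq_mul]
    rw [← hxy, ← add_mul, hst, one_mul]
  refine mem_frontier_of_isMaxOn hf (hQ.segment_subset hx hy hw) fun z hz => ?_
  rw [hfw]
  exact hmax_x hz

theorem interior_nonempty_of_measure_ne_zero [MeasurableSpace E] [BorelSpace E]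
    [FiniteDimensional ℝ E] (μ : Measure E) [μ.IsAddHaarMeasure] (hQ : Convex ℝ Q)
    (hμ : μ Q ≠ 0) : (interior Q).Nonempty := by
  by_contra hempty
  rw [not_nonempty_iff_eq_empty] at hempty
  refine hμ (measure_mono_null subset_closure ?_)
  simpa only [frontier, hempty, sdiff_empty] using hQ.addHaar_frontier μ

end Support

section Triangle

theorem plane_ext {x y : Plane} (h0 : x 0 = y 0) (h1 : x 1 = y 1) : x = y := by
  ext i
  fin_cases i
  exacts [h0, h1]

/-- The open triangle with vertices `(0, 0)`, `(1, 0)`, `(0, 1)`. -/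
def openStdTriangle : Set Plane := {w | 0 < w 0 ∧ 0 < w 1 ∧ w 0 + w 1 < 1}

/-- The closed triangle with vertices `(0, 0)`, `(1, 0)`, `(0, 1)`. -/
def closedStdTriangle : Set Plane := {w | 0 ≤ w 0 ∧ 0 ≤ w 1 ∧ w 0 + w 1 ≤ 1}

theorem isOpen_openStdTriangle : IsOpen openStdTriangle := by
  have h0 : Continuous fun w : Plane => w 0 := by fun_prop
  have h1 : Continuous fun w : Plane => w 1 := by fun_prop
  exact (isOpen_lt continuous_const h0).inter
    ((isOpen_lt continuous_const h1).inter (isOpen_lt (h0.add h1) continuous_const))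

theorem convex_openStdTriangle : Convex ℝ openStdTriangle := by
  rintro x ⟨hx0, hx1, hx⟩ y ⟨hy0, hy1, hy⟩ s t hs ht hst
  refine ⟨convex_Ioi (0 : ℝ) hx0 hy0 hs ht hst, convex_Ioi (0 : ℝ) hx1 hy1 hs ht hst, ?_⟩
  have hsum : s * (x 0 + x 1) + t * (y 0 + y 1) < 1 := convex_Iio (1 : ℝ) hx hy hs ht hst
  simp only [PiLp.add_apply, PiLp.smul_apply, smul_eq_mul]
  linarith

theorem closedStdTriangle_subset_closure : closedStdTriangle ⊆ closure openStdTriangle := by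
  rintro w ⟨hw0, hw1, hw⟩
  have hseg : openSegment ℝ w !₂[1 / 4, 1 / 4] ⊆ openStdTriangle := by
    rintro _ ⟨s, t, hs, ht, hst, rfl⟩
    simp only [openStdTriangle, mem_ofPred_eq, PiLp.add_apply, PiLp.smul_apply, smul_eq_mul,
      Matrix.cons_val_zero, Matrix.cons_val_one]
    exact ⟨by positivity, by positivity, by nlinarith⟩
  exact closure_mono hseg (segment_subset_closure_openSegment (left_mem_segment ℝ _ _))

theorem volume_openStdTriangle : volume openStdTriangle = ENNReal.ofReal (1 / 2) := by
  have hpres := (PiLp.volume_preserving_toLp (Fin 2)).comp (volume_preserving_finTwoArrow ℝ).symm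
  rw [← hpres.measure_preimage isOpen_openStdTriangle.measurableSet.nullMeasurableSet]
  have hregion : (WithLp.toLp 2 ∘ (MeasurableEquiv.finTwoArrow (α := ℝ)).symm) ⁻¹' openStdTriangle =
      regionBetween (fun _ => 0) (fun x => 1 - x) (Ioo 0 1) := by
    ext ⟨x, y⟩
    change 0 < x ∧ 0 < y ∧ x + y < 1 ↔ (0 < x ∧ x < 1) ∧ 0 < y ∧ y < 1 - x
    constructor
    · rintro ⟨hx, hy, hxy⟩
      exact ⟨⟨hx, by linarith⟩, hy, by linarith⟩
    · rintro ⟨⟨hx, -⟩, hy, hxy⟩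
      exact ⟨hx, hy, by linarith⟩
  have hintegral : ∫ x in Ioo (0 : ℝ) 1, (1 - x) = 1 / 2 := by
    rw [← integral_Ioc_eq_integral_Ioo, ← intervalIntegral.integral_of_le zero_le_one,
      intervalIntegral.integral_sub (by simp) (by simp)]
    norm_num
  have hint : IntegrableOn (fun x : ℝ => 1 - x) (Ioo 0 1) :=
    (Continuous.integrableOn_Icc (by fun_prop)).mono_set Ioo_subset_Icc_self
  rw [hregion, Measure.volume_eq_prod, volume_regionBetween_eq_integral integrableOn_zero hint
    measurableSet_Ioo fun x hx => (sub_pos.2 hx.2).le]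
  simp only [Pi.sub_apply, sub_zero, hintegral]

theorem volume_closedStdTriangle_le : volume closedStdTriangle ≤ ENNReal.ofReal (1 / 2) := by
  rw [← volume_openStdTriangle, ← measure_closure_of_null_frontier
    (convex_openStdTriangle.addHaar_frontier volume)]
  exact measure_mono closedStdTriangle_subset_closure

/-- The linear map sending the standard basis vectors to `a` and `b`. -/
def planeMap (a b : Plane) : Plane →ₗ[ℝ] Plane where
  toFun w := w 0 • a + w 1 • b
  map_add' x y := by
    simp only [PiLp.add_apply]
    module
  map_smul' r x := by
    simp only [PiLp.smul_apply, smul_eq_mul, RingHom.id_apply]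
    module

theorem planeMap_apply (a b w : Plane) : planeMap a b w = w 0 • a + w 1 • b := rfl

/-- The determinant of two plane vectors. -/
def cross (a b : Plane) : ℝ := a 0 * b 1 - a 1 * b 0

@[simp] theorem cross_self (a : Plane) : cross a a = 0 := by
  unfold cross
  ring

theorem cross_add_smul_right (a b c : Plane) (u v : ℝ) :
    cross a (u • b + v • c) = u * cross a b + v * cross a c := by
  simp only [cross, PiLp.add_apply, PiLp.smul_apply, smul_eq_mul]
  ring

theorem cross_add_smul_left (a b c : Plane) (u v : ℝ) :
    cross (u • b + v • c) a = u * cross b a + v * cross c a := by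
  simp only [cross, PiLp.add_apply, PiLp.smul_apply, smul_eq_mul]
  ring

theorem cross_smul_right (a b : Plane) (r : ℝ) : cross a (r • b) = r * cross a b := by
  simp only [cross, PiLp.smul_apply, smul_eq_mul]
  ring

theorem cross_smul_left (a b : Plane) (r : ℝ) : cross (r • a) b = r * cross a b := by
  simp only [cross, PiLp.smul_apply, smul_eq_mul]
  ring

theorem det_planeMap (a b : Plane) : LinearMap.det (planeMap a b) = cross a b := by
  rw [← LinearMap.det_toMatrix (EuclideanSpace.basisFun (Fin 2) ℝ).toBasis, Matrix.det_fin_two]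
  simp [LinearMap.toMatrix_apply, planeMap_apply, cross]
  ring

theorem volume_planeMap_image (a b : Plane) (T : Set Plane) :
    volume (planeMap a b '' T) = ENNReal.ofReal |cross a b| * volume T := by
  rw [Measure.addHaar_image_linearMap, det_planeMap]

end Triangle

section Kite

/-- The union of the images of `T` under the linear maps sending the standard basis to `a, q` and
to `q, b`. If `T` is the standard triangle this is the quadrilateral `0, a, q, b`, in which `q` is
the apex over the side `a b`. -/
def kite (T : Set Plane) (a b q : Plane) : Set Plane := planeMap a q '' T ∪ planeMap q b '' T

variable {a b : Plane} {u v : ℝ}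

theorem cross_combination_right (a b : Plane) (u v : ℝ) :
    cross a (u • a + v • b) = v * cross a b := by
  rw [cross_add_smul_right, cross_self, mul_zero, zero_add]

theorem cross_combination_left (a b : Plane) (u v : ℝ) :
    cross (u • a + v • b) b = u * cross a b := by
  rw [cross_add_smul_left, cross_self, mul_zero, add_zero]

theorem volume_triangles_eq (hab : 0 ≤ cross a b) (hu : 0 ≤ u) (hv : 0 ≤ v) :
    ENNReal.ofReal |cross a (u • a + v • b)| * ENNReal.ofReal (1 / 2) +
      ENNReal.ofReal |cross (u • a + v • b) b| * ENNReal.ofReal (1 / 2) =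
      ENNReal.ofReal (cross a b / 2 * (u + v)) := by
  rw [cross_combination_right, cross_combination_left, abs_of_nonneg (mul_nonneg hv hab),
    abs_of_nonneg (mul_nonneg hu hab), ← add_mul, ← ENNReal.ofReal_add (by positivity)
    (by positivity), ← ENNReal.ofReal_mul (by positivity)]
  congr 1
  ring

theorem volume_kite_closedStdTriangle_le (hab : 0 ≤ cross a b) (hu : 0 ≤ u) (hv : 0 ≤ v) :
    volume (kite closedStdTriangle a b (u • a + v • b)) ≤
      ENNReal.ofReal (cross a b / 2 * (u + v)) := by
  refine (measure_union_le _ _).trans ?_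
  rw [volume_planeMap_image, volume_planeMap_image, ← volume_triangles_eq hab hu hv]
  gcongr <;> exact volume_closedStdTriangle_le

theorem nullMeasurableSet_planeMap_image (a b : Plane) :
    NullMeasurableSet (planeMap a b '' openStdTriangle) :=
  (convex_openStdTriangle.linear_image _).nullMeasurableSet volume

theorem nullMeasurableSet_kite (a b q : Plane) : NullMeasurableSet (kite openStdTriangle a b q) :=
  (nullMeasurableSet_planeMap_image a q).union (nullMeasurableSet_planeMap_image q b)

theorem disjoint_planeMap_image {q : Plane} (haq : 0 < cross a q) (hqb : 0 < cross q b) :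
    Disjoint (planeMap a q '' openStdTriangle) (planeMap q b '' openStdTriangle) := by
  rw [Set.disjoint_left]
  rintro _ ⟨w, ⟨hw0, -, -⟩, rfl⟩ ⟨w', ⟨-, hw1', -⟩, heq⟩
  have hcross := congrArg (cross q) heq
  have hqa : cross q a = -cross a q := by
    unfold cross
    ring
  rw [planeMap_apply, planeMap_apply, cross_add_smul_right, cross_add_smul_right, cross_self,
    hqa] at hcross
  linarith [mul_pos hw1' hqb, mul_pos hw0 haq]

theorem volume_kite_openStdTriangle (hab : 0 < cross a b) (hu : 0 < u) (hv : 0 < v) :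
    volume (kite openStdTriangle a b (u • a + v • b)) =
      ENNReal.ofReal (cross a b / 2 * (u + v)) := by
  have hdisj : Disjoint (planeMap a (u • a + v • b) '' openStdTriangle)
      (planeMap (u • a + v • b) b '' openStdTriangle) := by
    apply disjoint_planeMap_image
    · rw [cross_combination_right]
      positivity
    · rw [cross_combination_left]
      positivity
  rw [kite, measure_union₀ (nullMeasurableSet_planeMap_image _ _) hdisj.aedisjoint,
    volume_planeMap_image, volume_planeMap_image, volume_openStdTriangle,
    volume_triangles_eq hab.le hu.le hv.le]

theorem exists_pos_combination_of_mem_kite (hu : 0 < u) (hv : 0 < v) {x : Plane}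
    (hx : x ∈ kite openStdTriangle a b (u • a + v • b)) :
    ∃ s t : ℝ, 0 < s ∧ 0 < t ∧ x = s • a + t • b := by
  obtain ⟨w, ⟨hw0, hw1, -⟩, rfl⟩ | ⟨w, ⟨hw0, hw1, -⟩, rfl⟩ := hx
  · refine ⟨w 0 + w 1 * u, w 1 * v, by positivity, by positivity, ?_⟩
    rw [planeMap_apply]
    module
  · refine ⟨w 0 * u, w 0 * v + w 1, by positivity, by positivity, ?_⟩
    rw [planeMap_apply]
    module

theorem planeMap_image_subset {Q : Set Plane} (hQ : Convex ℝ Q) {c : Plane} (hc : c ∈ Q)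
    (ha : c + a ∈ Q) (hb : c + b ∈ Q) :
    planeMap a b '' openStdTriangle ⊆ (c + ·) ⁻¹' Q := by
  rintro _ ⟨w, ⟨hw0, hw1, hw⟩, rfl⟩
  have hmem := hQ.sum_mem (t := Finset.univ) (w := ![1 - w 0 - w 1, w 0, w 1])
    (z := ![c, c + a, c + b])
    (by intro i _; fin_cases i; exacts [show 0 ≤ 1 - w 0 - w 1 by linarith, hw0.le, hw1.le])
    (by rw [Fin.sum_univ_three]; exact show 1 - w 0 - w 1 + w 0 + w 1 = 1 by ring)
    (by intro i _; fin_cases i; exacts [hc, ha, hb])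
  simp only [Fin.sum_univ_three, Matrix.cons_val_zero, Matrix.cons_val_one, Matrix.cons_val] at hmem
  rw [mem_preimage, planeMap_apply]
  convert hmem using 1
  module

theorem kite_subset {Q : Set Plane} (hQ : Convex ℝ Q) {c q : Plane} (hc : c ∈ Q) (ha : c + a ∈ Q)
    (hb : c + b ∈ Q) (hq : c + q ∈ Q) : kite openStdTriangle a b q ⊆ (c + ·) ⁻¹' Q :=
  union_subset (planeMap_image_subset hQ hc ha hq) (planeMap_image_subset hQ hc hq hb)

end Kite

section Circle

/-- The point of the unit circle with polar angle `x`. -/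
def circ (x : ℝ) : Plane := !₂[cos x, sin x]

@[simp] theorem circ_apply_zero (x : ℝ) : circ x 0 = cos x := rfl

@[simp] theorem circ_apply_one (x : ℝ) : circ x 1 = sin x := rfl

theorem cross_circ (x y : ℝ) : cross (circ x) (circ (x + y)) = sin y := by
  simp only [cross, circ_apply_zero, circ_apply_one, cos_add, sin_add]
  linear_combination sin y * sin_sq_add_cos_sq x

theorem circ_add_congr {x x' : ℝ} (h : circ x = circ x') (y : ℝ) :
    circ (x + y) = circ (x' + y) := by
  have hcos : cos x = cos x' := congrArg (fun w : Plane => w 0) h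
  have hsin : sin x = sin x' := congrArg (fun w : Plane => w 1) h
  apply plane_ext
  · simp only [circ_apply_zero, cos_add, hcos, hsin]
  · simp only [circ_apply_one, sin_add, hcos, hsin]

theorem circ_sub_add_circ_add (x δ : ℝ) :
    circ (x - δ) + circ (x + δ) = (2 * cos δ) • circ x := by
  apply plane_ext
  · simp only [PiLp.add_apply, PiLp.smul_apply, circ_apply_zero, smul_eq_mul, cos_sub, cos_add]
    ring
  · simp only [PiLp.add_apply, PiLp.smul_apply, circ_apply_one, smul_eq_mul, sin_sub, sin_add]
    ring

theorem circ_add_eq_combination {δ : ℝ} (hδ : sin δ ≠ 0) (x y : ℝ) :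
    circ (x + y) = (sin (δ - y) / sin δ) • circ x + (sin y / sin δ) • circ (x + δ) := by
  apply plane_ext
  · simp only [PiLp.add_apply, PiLp.smul_apply, circ_apply_zero, smul_eq_mul, cos_add, sin_sub]
    field_simp
    ring
  · simp only [PiLp.add_apply, PiLp.smul_apply, circ_apply_one, smul_eq_mul, sin_add, sin_sub]
    field_simp
    ring

theorem exists_eq_smul_circ_add (x : ℝ) (w : Plane) :
    ∃ r : ℝ, 0 ≤ r ∧ ∃ y ∈ Ico 0 (2 * π), w = r • circ (x + y) := by
  obtain ⟨η, hη⟩ : ∃ η, w = ‖(⟨w 0, w 1⟩ : ℂ)‖ • circ η :=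
    ⟨Complex.arg ⟨w 0, w 1⟩, plane_ext (Complex.norm_mul_cos_arg ⟨w 0, w 1⟩).symm
      (Complex.norm_mul_sin_arg ⟨w 0, w 1⟩).symm⟩
  refine ⟨_, norm_nonneg (⟨w 0, w 1⟩ : ℂ), toIcoMod two_pi_pos 0 (η - x), ?_, hη.trans ?_⟩
  · simpa only [zero_add] using toIcoMod_mem_Ico two_pi_pos 0 (η - x)
  · have hmod : x + toIcoMod two_pi_pos 0 (η - x) =
        η - toIcoDiv two_pi_pos 0 (η - x) * (2 * π) := by
      rw [← self_sub_toIcoDiv_zsmul, zsmul_eq_mul]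
      ring
    congr 1
    rw [hmod]
    apply plane_ext
    · rw [circ_apply_zero, circ_apply_zero, cos_sub_int_mul_two_pi]
    · rw [circ_apply_one, circ_apply_one, sin_sub_int_mul_two_pi]

theorem clm_ext_circ {δ : ℝ} (hδ : sin δ ≠ 0) (x : ℝ) {f g : Plane →L[ℝ] ℝ}
    (h : f (circ x) = g (circ x)) (hadd : f (circ (x + δ)) = g (circ (x + δ))) : f = g := by
  ext w
  obtain ⟨r, -, y, -, rfl⟩ := exists_eq_smul_circ_add x w
  rw [circ_add_eq_combination hδ]
  simp only [map_smul, map_add, h, hadd]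

/-- The functional with value `1` at `circ x` and value `w` at the tangent direction
`circ (x + π / 2)`; its level lines are the lines of slope parameter `w` near `circ x`. -/
def suppFun (w x : ℝ) : Plane →L[ℝ] ℝ := innerSL ℝ (circ x + w • circ (x + π / 2))

theorem suppFun_circ_add (w x y : ℝ) : suppFun w x (circ (x + y)) = cos y + w * sin y := by
  simp only [suppFun, innerSL_apply_apply, PiLp.inner_apply, Fin.sum_univ_two, PiLp.add_apply,
    PiLp.smul_apply, circ_apply_zero, circ_apply_one, smul_eq_mul, cos_add, sin_add,
    cos_pi_div_two, sin_pi_div_two, RCLike.inner_apply, conj_trivial]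
  linear_combination (cos y + w * sin y) * sin_sq_add_cos_sq x

theorem suppFun_circ_sub (w x y : ℝ) : suppFun w x (circ (x - y)) = cos y - w * sin y := by
  rw [sub_eq_add_neg, suppFun_circ_add, cos_neg, sin_neg, mul_neg, ← sub_eq_add_neg]

theorem suppFun_circ_self (w x : ℝ) : suppFun w x (circ x) = 1 := by
  simpa only [add_zero, cos_zero, sin_zero, mul_zero] using suppFun_circ_add w x 0

variable {α x : ℝ} {f : Plane →L[ℝ] ℝ}

theorem tan_mul_sin_two_mul (hα : α ∈ Ioo 0 (π / 4)) : tan α * sin (2 * α) = 1 - cos (2 * α) := by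
  have hcos := (cos_pos_of_lt_pi_div_four hα).ne'
  rw [← tan_mul_one_add_cos_two_mul hcos, ← tan_sq_mul_one_add_cos_two_mul hcos]
  ring

theorem two_mul_cos_mul_eq_add (f : Plane →L[ℝ] ℝ) (x δ : ℝ) :
    2 * cos δ * f (circ x) = f (circ (x - δ)) + f (circ (x + δ)) := by
  rw [← map_add, circ_sub_add_circ_add, map_smul, smul_eq_mul]

theorem pos_of_apply_circ_le (hα : α ∈ Ioo 0 (π / 4)) (hf : f ≠ 0)
    (hnext : f (circ (x + 2 * α)) ≤ f (circ x)) (hprev : f (circ (x - 2 * α)) ≤ f (circ x)) :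
    0 < f (circ x) := by
  have hsum := two_mul_cos_mul_eq_add f x (2 * α)
  have hM := one_sub_cos_two_mul_pos hα
  have hnonneg : 0 ≤ f (circ x) := by nlinarith
  refine hnonneg.lt_of_ne fun h0 => hf ?_
  rw [← h0, mul_zero] at hsum
  apply clm_ext_circ (sin_two_mul_pos_of_lt_pi_div_four hα).ne' x
  · exact h0.symm
  · change f (circ (x + 2 * α)) = 0
    linarith

theorem exists_eq_smul_suppFun (hα : α ∈ Ioo 0 (π / 4)) (hf : f ≠ 0)
    (hnext : f (circ (x + 2 * α)) ≤ f (circ x)) (hprev : f (circ (x - 2 * α)) ≤ f (circ x)) :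
    ∃ r ∈ Icc (-1 : ℝ) 1, f = f (circ x) • suppFun (tan α * r) x := by
  have hsum := two_mul_cos_mul_eq_add f x (2 * α)
  have hpos := pos_of_apply_circ_le hα hf hnext hprev
  have hM := one_sub_cos_two_mul_pos hα
  set r := (f (circ (x + 2 * α)) / f (circ x) - cos (2 * α)) / (1 - cos (2 * α)) with hr
  have hr_next : f (circ (x + 2 * α)) = f (circ x) * (cos (2 * α) + r * (1 - cos (2 * α))) := by
    rw [hr]
    field_simp
    ring
  have hle : f (circ x) * (1 - cos (2 * α)) * r ≤ f (circ x) * (1 - cos (2 * α)) * 1 := by linarith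
  have hge : f (circ x) * (1 - cos (2 * α)) * -1 ≤ f (circ x) * (1 - cos (2 * α)) * r := by linarith
  refine ⟨r, ⟨le_of_mul_le_mul_left hge (mul_pos hpos hM),
    le_of_mul_le_mul_left hle (mul_pos hpos hM)⟩, ?_⟩
  apply clm_ext_circ (sin_two_mul_pos_of_lt_pi_div_four hα).ne' x
  · rw [smul_apply, suppFun_circ_self, smul_eq_mul, mul_one]
  · rw [smul_apply, suppFun_circ_add, smul_eq_mul, hr_next,
      ← tan_mul_sin_two_mul hα]
    ring

end Circle

section Apex

variable {A B : ℝ}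

theorem exists_apex (hA : A ∈ Ico 0 2) (hB : B ∈ Ico 0 2) :
    ∃ u v : ℝ, 0 ≤ u ∧ 0 ≤ v ∧ u + v = 1 + excess A B ∧ u + (1 - A) * v = 1 ∧
      (1 - B) * u + v = 1 := by
  rcases (add_nonneg hA.1 hB.1).lt_or_eq with h | h
  · have hD := excess_denom_pos hA hB h
    refine ⟨A / (A + B - A * B), B / (A + B - A * B), div_nonneg hA.1 hD.le,
      div_nonneg hB.1 hD.le, ?_, ?_, ?_⟩
    · unfold excess
      field_simp
      ring
    all_goals
      rw [mul_div_assoc', ← add_div, div_eq_one_iff_eq hD.ne']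
      ring
  · obtain ⟨rfl, rfl⟩ : A = 0 ∧ B = 0 := (add_eq_zero_iff_of_nonneg hA.1 hB.1).1 h.symm
    exact ⟨1, 0, by simp⟩

theorem exists_apex_pos (hA : A ∈ Ico 0 2) (hB : B ∈ Ico 0 2) :
    ∃ u v : ℝ, 0 < u ∧ 0 < v ∧ u + v = 1 + excess A B ∧ u + (1 - A) * v ≤ 1 ∧
      (1 - B) * u + v ≤ 1 := by
  rcases (excess_nonneg hA hB).lt_or_eq with hpos | hzero
  · obtain ⟨hA0, hB0⟩ := (excess_pos_iff hA hB).1 hpos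
    obtain ⟨u, v, hu, hv, hsum, hleft, hright⟩ := exists_apex hA hB
    refine ⟨u, v, hu.lt_of_ne ?_, hv.lt_of_ne ?_, hsum, hleft.le, hright.le⟩
    · rintro rfl
      linarith
    · rintro rfl
      linarith
  · refine ⟨1 / 2, 1 / 2, by norm_num, by norm_num, by rw [← hzero]; norm_num, ?_, ?_⟩
    · linarith [hA.1]
    · linarith [hB.1]

theorem exists_triangle_combination {a b : Plane} {u v x y : ℝ} (hv : 0 ≤ v)
    (hapex : u + (1 - A) * v = 1) (hx : 0 ≤ x) (hy : 0 ≤ y) (hside : x + (1 - A) * y ≤ 1)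
    (hcut : u * y ≤ v * x) :
    ∃ s t : ℝ, 0 ≤ s ∧ 0 ≤ t ∧ s + t ≤ 1 ∧ s • a + t • (u • a + v • b) = x • a + y • b := by
  rcases hv.lt_or_eq with hv | rfl
  · have hA : y / v * ((1 - A) * v) = (1 - A) * y := by field_simp
    refine ⟨x - y / v * u, y / v, ?_, by positivity, ?_, ?_⟩
    · rw [sub_nonneg, div_mul_eq_mul_div, div_le_iff₀ hv]
      linarith
    · linarith [congrArg (y / v * ·) hapex, mul_add (y / v) u ((1 - A) * v)]
    · have hyv : y / v * v = y := by field_simp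
      rw [smul_add, smul_smul, smul_smul, hyv]
      module
  · obtain rfl : u = 1 := by linarith
    obtain rfl : y = 0 := by linarith
    exact ⟨x, 0, hx, le_rfl, by linarith, by module⟩

theorem mem_kite_closedStdTriangle {a b : Plane} {u v x y : ℝ} (hu : 0 ≤ u) (hv : 0 ≤ v)
    (hleft : u + (1 - A) * v = 1) (hright : (1 - B) * u + v = 1) (hx : 0 ≤ x) (hy : 0 ≤ y)
    (hxy : x + (1 - A) * y ≤ 1) (hyx : (1 - B) * x + y ≤ 1) :
    x • a + y • b ∈ kite closedStdTriangle a b (u • a + v • b) := by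
  rcases le_total (u * y) (v * x) with h | h
  · left
    obtain ⟨s, t, hs, ht, hst, heq⟩ := exists_triangle_combination (a := a) (b := b) hv hleft hx hy
      hxy h
    exact ⟨!₂[s, t], ⟨hs, ht, hst⟩, heq⟩
  · right
    obtain ⟨s, t, hs, ht, hst, heq⟩ := exists_triangle_combination (a := b) (b := a) hu
      ((add_comm _ _).trans hright) hy hx ((add_comm _ _).trans_le hyx) h
    refine ⟨!₂[t, s], ⟨ht, hs, (add_comm _ _).trans_le hst⟩, ?_⟩
    rw [add_comm (x • a), ← heq, add_comm (u • a)]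
    exact add_comm _ _

end Apex

section Circumscribed

variable {n : ℕ} {p : ZMod n → Plane} {Q : Set Plane}

theorem IsCircumscribed.convex (hQ : IsCircumscribed p Q) : Convex ℝ Q := by
  obtain ⟨⟨⟨F, -, rfl⟩, -⟩, -⟩ := hQ
  exact convex_convexHull ℝ F

theorem IsCircumscribed.vertex_mem (hQ : IsCircumscribed p Q) (i : ZMod n) : p i ∈ Q :=
  hQ.2.1 (subset_convexHull ℝ _ ⟨i, rfl⟩)

theorem IsCircumscribed.exists_isMaxOn (hQ : IsCircumscribed p Q) {x : Plane}
    (hx : x ∈ frontier Q) : ∃ f : Plane →L[ℝ] ℝ, f ≠ 0 ∧ IsMaxOn f Q x :=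
  geometric_hahn_banach_of_nonempty_interior_point hQ.convex hx.2 hQ.1.2

end Circumscribed

/-- Polar coordinates for a regular `n`-gon of unit circumradius, `n ≥ 5`: its center is `c`, the
polar angle of the vertex `p i` about `c` is `θ i`, and its central angles are `2 * α`. -/
structure IsPolarForm {n : ℕ} (p : ZMod n → Plane) (c : Plane) (θ : ZMod n → ℝ) (α : ℝ) :
    Prop where
  mem_Ioo : α ∈ Ioo 0 (π / 4)
  natCast_mul : n * α = π
  vertex_add : ∀ (i : ZMod n) (k : ℕ), p (i + k) = c + circ (θ i + 2 * α * k)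

theorem IsUnitRegularNgon.exists_isPolarForm {n : ℕ} (hn : 5 ≤ n) {p : ZMod n → Plane}
    (hp : IsUnitRegularNgon p) : ∃ c θ, IsPolarForm p c θ (π / n) := by
  obtain ⟨c, φ, hp⟩ := hp
  have hn4 : (4 : ℝ) < n := by exact_mod_cast hn
  have hn0 : (0 : ℝ) < n := by linarith
  have : NeZero n := ⟨by omega⟩
  refine ⟨c, fun i => φ + 2 * (π / n) * i.val, ⟨by positivity, ?_⟩, by field_simp, fun i k => ?_⟩
  · exact div_lt_div_of_pos_left pi_pos (by norm_num) hn4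
  · have hvertex := hp (i.val + k)
    rw [Nat.cast_add, ZMod.natCast_zmod_val] at hvertex
    have hangle : φ + 2 * π * ((i.val + k : ℕ) : ℝ) / n =
        φ + 2 * (π / n) * i.val + 2 * (π / n) * k := by
      push_cast
      ring
    rw [hvertex, hangle]
    rfl

theorem exists_eq_add_natCast {n : ℕ} [NeZero n] (i j : ZMod n) : ∃ k < n, j = i + (k : ZMod n) :=
  ⟨(j - i).val, ZMod.val_lt _, by rw [ZMod.natCast_zmod_val, add_sub_cancel]⟩

/-- `Q` lies on the inner side of the lines through the points `c + circ (θ i)` that have slope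
`tan α * z i` relative to the tangent of the circle. For `z i = 1` and `z i = -1` the line contains
the side of the regular polygon that starts and ends at the point, respectively. -/
def HasSlopes {n : ℕ} (c : Plane) (θ : ZMod n → ℝ) (α : ℝ) (Q : Set Plane) (z : ZMod n → ℝ) :
    Prop :=
  ∀ i, ∀ x ∈ Q, suppFun (tan α * z i) (θ i) (x - c) ≤ 1

theorem suppFun_side_left {α : ℝ} (hα : α ∈ Ioo 0 (π / 4)) (x r u v : ℝ) :
    suppFun (tan α * r) x (u • circ x + v • circ (x + 2 * α)) =
      u + (1 - (1 - cos (2 * α)) * (1 - r)) * v := by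
  rw [map_add, map_smul, map_smul, suppFun_circ_self, suppFun_circ_add, smul_eq_mul, smul_eq_mul]
  linear_combination v * r * tan_mul_sin_two_mul hα

theorem suppFun_side_right {α : ℝ} (hα : α ∈ Ioo 0 (π / 4)) (x r u v : ℝ) :
    suppFun (tan α * r) (x + 2 * α) (u • circ x + v • circ (x + 2 * α)) =
      (1 - (1 - cos (2 * α)) * (1 + r)) * u + v := by
  have hstart := suppFun_circ_sub (tan α * r) (x + 2 * α) (2 * α)
  rw [add_sub_cancel_right] at hstart
  rw [map_add, map_smul, map_smul, suppFun_circ_self, hstart, smul_eq_mul, smul_eq_mul]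
  linear_combination -u * r * tan_mul_sin_two_mul hα

theorem suppFun_ne_zero (w x : ℝ) : suppFun w x ≠ 0 := fun h => by
  simpa only [suppFun_circ_self, h, zero_apply, zero_ne_one] using suppFun_circ_self w x

theorem suppFun_congr {x x' : ℝ} (h : circ x = circ x') (w : ℝ) : suppFun w x = suppFun w x' := by
  unfold suppFun
  rw [h, circ_add_congr h]

theorem exists_mem_Ico_sector {α y : ℝ} (hα : 0 < α) (hy : 0 ≤ y) :
    ∃ k : ℕ, y - 2 * α * k ∈ Ico 0 (2 * α) := by
  have hα2 : 0 < 2 * α := by linarith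
  refine ⟨⌊y / (2 * α)⌋₊, ?_, ?_⟩
  · have hle := Nat.floor_le (div_nonneg hy hα2.le)
    rw [le_div_iff₀ hα2] at hle
    linarith
  · have hlt := Nat.lt_floor_add_one (y / (2 * α))
    rw [div_lt_iff₀ hα2] at hlt
    linarith

theorem pos_of_smul_circ_eq_combination {α x y r u v : ℝ} (hα : 0 < sin (2 * α)) (hr : 0 ≤ r)
    (hu : 0 < u) (hv : 0 < v) (h : r • circ (x + y) = u • circ x + v • circ (x + 2 * α)) :
    0 < sin y ∧ 0 < sin (2 * α - y) := by
  have hleft := congrArg (cross (circ x)) h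
  have hright := congrArg (cross · (circ (x + 2 * α))) h
  have hrotate : x + 2 * α = x + y + (2 * α - y) := by ring
  rw [cross_combination_right, cross_circ, cross_smul_right, cross_circ] at hleft
  rw [cross_combination_left, cross_circ, cross_smul_left, hrotate, cross_circ] at hright
  exact ⟨pos_of_mul_pos_right (hleft ▸ mul_pos hv hα) hr,
    pos_of_mul_pos_right (hright ▸ mul_pos hu hα) hr⟩

theorem lt_of_sin_pos_of_sin_sub_pos {y δ : ℝ} (hδ : δ ∈ Icc 0 π) (hy : y ∈ Ico 0 (2 * π))
    (hsin : 0 < sin y) (hsub : 0 < sin (δ - y)) : y < δ := by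
  by_contra! hle
  rcases le_total y π with hyπ | hyπ
  · linarith [sin_nonpos_of_nonpos_of_neg_pi_le (x := δ - y) (by linarith) (by linarith [hδ.1])]
  · have := sin_nonneg_of_nonneg_of_le_pi (x := y - π) (by linarith) (by linarith [hy.2])
    rw [sin_sub_pi] at this
    linarith

namespace IsPolarForm

variable {n : ℕ} {p : ZMod n → Plane} {c : Plane} {θ : ZMod n → ℝ} {α : ℝ}

theorem vertex (hF : IsPolarForm p c θ α) (i : ZMod n) : p i = c + circ (θ i) := by
  simpa only [Nat.cast_zero, add_zero, mul_zero] using hF.vertex_add i 0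

theorem vertex_add_one (hF : IsPolarForm p c θ α) (i : ZMod n) :
    p (i + 1) = c + circ (θ i + 2 * α) := by
  simpa only [Nat.cast_one, mul_one] using hF.vertex_add i 1

theorem circ_angle_add (hF : IsPolarForm p c θ α) (i : ZMod n) (k : ℕ) :
    circ (θ (i + k)) = circ (θ i + 2 * α * k) :=
  add_left_cancel ((hF.vertex _).symm.trans (hF.vertex_add i k))

theorem circ_angle_add_one (hF : IsPolarForm p c θ α) (i : ZMod n) :
    circ (θ (i + 1)) = circ (θ i + 2 * α) :=
  add_left_cancel ((hF.vertex _).symm.trans (hF.vertex_add_one i))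

theorem vertex_sub_one (hF : IsPolarForm p c θ α) (i : ZMod n) :
    p (i - 1) = c + circ (θ i - 2 * α) := by
  have hprev := hF.circ_angle_add_one (i - 1)
  rw [sub_add_cancel] at hprev
  rw [hF.vertex, sub_eq_add_neg (θ i), circ_add_congr hprev, add_neg_cancel_right]

theorem exists_sector (hF : IsPolarForm p c θ α) (w : Plane) :
    ∃ i, ∃ u v : ℝ, 0 ≤ u ∧ 0 ≤ v ∧ w = u • circ (θ i) + v • circ (θ i + 2 * α) := by
  obtain ⟨r, hr, y, hy, rfl⟩ := exists_eq_smul_circ_add (θ 0) w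
  obtain ⟨k, hk0, hk⟩ := exists_mem_Ico_sector hF.mem_Ioo.1 hy.1
  have hs := sin_two_mul_pos_of_lt_pi_div_four hF.mem_Ioo
  have hcoeff : ∀ t, 0 ≤ t → t ≤ 2 * α → 0 ≤ r * (sin t / sin (2 * α)) := fun t h0 h =>
    mul_nonneg hr (div_nonneg (sin_nonneg_of_nonneg_of_le_pi h0
      (by linarith [hF.mem_Ioo.2, pi_pos])) hs.le)
  refine ⟨0 + k, r * (sin (2 * α - (y - 2 * α * k)) / sin (2 * α)),
    r * (sin (y - 2 * α * k) / sin (2 * α)), hcoeff _ (by linarith) (by linarith),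
    hcoeff _ hk0 hk.le, ?_⟩
  have hangle : circ (θ 0 + y) = circ (θ (0 + k) + (y - 2 * α * k)) := by
    rw [circ_add_congr (hF.circ_angle_add 0 k)]
    congr 1
    ring
  rw [hangle, circ_add_eq_combination hs.ne', smul_add, smul_smul, smul_smul]

theorem eq_of_combination_eq [NeZero n] (hF : IsPolarForm p c θ α) {i j : ZMod n} {u v u' v' : ℝ}
    (hu : 0 < u) (hv : 0 < v) (hu' : 0 < u') (hv' : 0 < v')
    (h : u • circ (θ i) + v • circ (θ i + 2 * α) = u' • circ (θ j) + v' • circ (θ j + 2 * α)) :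
    i = j := by
  obtain ⟨k, hkn, rfl⟩ := exists_eq_add_natCast i j
  obtain ⟨r, hr, y, hy, hry⟩ := exists_eq_smul_circ_add (θ i)
    (u • circ (θ i) + v • circ (θ i + 2 * α))
  have hs := sin_two_mul_pos_of_lt_pi_div_four hF.mem_Ioo
  obtain ⟨hi, hi'⟩ := pos_of_smul_circ_eq_combination hs hr hu hv hry.symm
  have hangle : θ i + y = θ i + 2 * α * k + (y - 2 * α * k) := by ring
  rw [h, hangle, ← circ_add_congr (hF.circ_angle_add i k)] at hry
  obtain ⟨hj, hj'⟩ := pos_of_smul_circ_eq_combination hs hr hu' hv' hry.symm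
  obtain ⟨hα0, hα⟩ := hF.mem_Ioo
  have hδ : 2 * α ∈ Icc 0 π := ⟨by linarith, by linarith⟩
  have hyα := lt_of_sin_pos_of_sin_sub_pos hδ hy hi hi'
  by_contra hne
  have hk : 1 ≤ k := Nat.one_le_iff_ne_zero.2 fun h0 => hne (by rw [h0, Nat.cast_zero, add_zero])
  have hk1 : (1 : ℝ) ≤ k := by exact_mod_cast hk
  have hkn1 : (k : ℝ) + 1 ≤ n := by exact_mod_cast hkn
  have hsum : 2 * α * k + 2 * α ≤ 2 * π := by nlinarith [hF.natCast_mul]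
  have hy' : y - 2 * α * k + 2 * π ∈ Ico 0 (2 * π) := ⟨by linarith [hy.1], by nlinarith⟩
  rw [← sin_add_two_pi] at hj
  rw [← sin_sub_two_pi, sub_sub] at hj'
  linarith [lt_of_sin_pos_of_sin_sub_pos hδ hy' hj hj', hy.1]

theorem suppFun_angle_add_one (hF : IsPolarForm p c θ α) (w : ℝ) (i : ZMod n) :
    suppFun w (θ (i + 1)) = suppFun w (θ i + 2 * α) :=
  suppFun_congr (hF.circ_angle_add_one i) w

end IsPolarForm

section UpperBound

variable {n : ℕ} {p : ZMod n → Plane} {c : Plane} {θ : ZMod n → ℝ} {α : ℝ} {Q : Set Plane}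
  {z : ZMod n → ℝ}

theorem IsPolarForm.exists_hasSlopes (hF : IsPolarForm p c θ α) (hQ : IsCircumscribed p Q) :
    ∃ z ∈ Icc (-1 : ZMod n → ℝ) 1, HasSlopes c θ α Q z := by
  suffices h : ∀ i, ∃ r ∈ Icc (-1 : ℝ) 1, ∀ x ∈ Q, suppFun (tan α * r) (θ i) (x - c) ≤ 1 by
    choose z hz hslope using h
    exact ⟨z, ⟨fun i => (hz i).1, fun i => (hz i).2⟩, hslope⟩
  intro i
  obtain ⟨f, hf0, hmax⟩ := hQ.exists_isMaxOn (hQ.2.2 i)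
  have hnext : f (p (i + 1)) ≤ f (p i) := hmax (hQ.vertex_mem (i + 1))
  have hprev : f (p (i - 1)) ≤ f (p i) := hmax (hQ.vertex_mem (i - 1))
  rw [hF.vertex_add_one, hF.vertex i, map_add, map_add, add_le_add_iff_left] at hnext
  rw [hF.vertex_sub_one, hF.vertex i, map_add, map_add, add_le_add_iff_left] at hprev
  have hpos := pos_of_apply_circ_le hF.mem_Ioo hf0 hnext hprev
  obtain ⟨r, hr, hfr⟩ := exists_eq_smul_suppFun hF.mem_Ioo hf0 hnext hprev
  refine ⟨r, hr, fun x hx => le_of_mul_le_mul_left ?_ hpos⟩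
  have hle : f x ≤ f (p i) := hmax hx
  rw [hF.vertex, map_add] at hle
  rw [← smul_eq_mul, ← smul_apply, ← hfr, map_sub]
  linarith

theorem IsPolarForm.add_le_one_of_side_subset (hF : IsPolarForm p c θ α)
    (hQ : IsCircumscribed p Q) {i : ZMod n} (hi : side p i ⊆ frontier Q) {u v : ℝ}
    (huv : c + (u • circ (θ i) + v • circ (θ i + 2 * α)) ∈ Q) : u + v ≤ 1 := by
  obtain ⟨f, hf0, hmax⟩ := hQ.exists_isMaxOn (hi (midpoint_mem_segment (p i) (p (i + 1))))
  have hmid : f (midpoint ℝ (p i) (p (i + 1))) = (f (p i) + f (p (i + 1))) / 2 := by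
    rw [midpoint_eq_smul_add, map_smul, map_add, smul_eq_mul, invOf_eq_inv]
    ring
  have hmax' : ∀ x ∈ Q, f x ≤ (f (p i) + f (p (i + 1))) / 2 := fun x hx => (hmax hx).trans_eq hmid
  have hi0 := hmax' _ (hQ.vertex_mem i)
  have hi1 := hmax' _ (hQ.vertex_mem (i + 1))
  have hprev := hmax' _ (hQ.vertex_mem (i - 1))
  have hapex := hmax' _ huv
  rw [hF.vertex_add_one, hF.vertex] at hi0 hi1 hapex
  rw [hF.vertex_sub_one, hF.vertex_add_one, hF.vertex] at hprev
  simp only [map_add, map_smul, smul_eq_mul] at hi0 hi1 hprev hapex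
  have heq : f (circ (θ i + 2 * α)) = f (circ (θ i)) := by linarith
  have hpos := pos_of_apply_circ_le hF.mem_Ioo hf0 heq.le (by linarith)
  refine le_of_mul_le_mul_right ?_ hpos
  rw [heq] at hapex
  linarith

theorem HasSlopes.le_one (hQ : HasSlopes c θ α Q z) (hF : IsPolarForm p c θ α) {i : ZMod n}
    {u v : ℝ} (huv : c + (u • circ (θ i) + v • circ (θ i + 2 * α)) ∈ Q) :
    u + (1 - (1 - cos (2 * α)) * (1 - z i)) * v ≤ 1 ∧
      (1 - (1 - cos (2 * α)) * (1 + z (i + 1))) * u + v ≤ 1 := by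
  have hleft := hQ i _ huv
  have hright := hQ (i + 1) _ huv
  rw [add_sub_cancel_left] at hleft hright
  rw [suppFun_side_left hF.mem_Ioo] at hleft
  rw [hF.suppFun_angle_add_one, suppFun_side_right hF.mem_Ioo] at hright
  exact ⟨hleft, hright⟩

theorem IsPolarForm.volume_le (hF : IsPolarForm p c θ α) [NeZero n] {A B : ZMod n → ℝ}
    (hA : ∀ i, A i ∈ Ico 0 2) (hB : ∀ i, B i ∈ Ico 0 2)
    (hQ : ∀ i u v, c + (u • circ (θ i) + v • circ (θ i + 2 * α)) ∈ Q →
      u + (1 - A i) * v ≤ 1 ∧ (1 - B i) * u + v ≤ 1) :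
    volume Q ≤ ∑ i, ENNReal.ofReal (sin (2 * α) / 2 * (1 + excess (A i) (B i))) := by
  choose u v hu hv huv hleft hright using fun i => exists_apex (hA i) (hB i)
  have hcover : (c + ·) ⁻¹' Q ⊆ ⋃ i, kite closedStdTriangle (circ (θ i)) (circ (θ i + 2 * α))
      (u i • circ (θ i) + v i • circ (θ i + 2 * α)) := by
    intro x hx
    obtain ⟨i, s, t, hs, ht, rfl⟩ := hF.exists_sector x
    obtain ⟨hst, hts⟩ := hQ i s t hx
    exact mem_iUnion.2 ⟨i, mem_kite_closedStdTriangle (hu i) (hv i) (hleft i) (hright i) hs ht hst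
      hts⟩
  rw [← measure_preimage_add volume c Q]
  refine (measure_mono hcover).trans ((measure_iUnion_fintype_le _ _).trans ?_)
  refine Finset.sum_le_sum fun i _ => ?_
  rw [← huv, ← cross_circ (θ i)]
  refine volume_kite_closedStdTriangle_le ?_ (hu i) (hv i)
  rw [cross_circ]
  exact (sin_two_mul_pos_of_lt_pi_div_four hF.mem_Ioo).le

theorem IsPolarForm.area_le (hF : IsPolarForm p c θ α) [NeZero n] {A B : ZMod n → ℝ}
    (hA : ∀ i, A i ∈ Ico 0 2) (hB : ∀ i, B i ∈ Ico 0 2)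
    (hQ : ∀ i u v, c + (u • circ (θ i) + v • circ (θ i + 2 * α)) ∈ Q →
      u + (1 - A i) * v ≤ 1 ∧ (1 - B i) * u + v ≤ 1) :
    area Q ≤ sin (2 * α) / 2 * (n + ∑ i, excess (A i) (B i)) := by
  have hs := sin_two_mul_pos_of_lt_pi_div_four hF.mem_Ioo
  have hterm : ∀ i, 0 ≤ sin (2 * α) / 2 * (1 + excess (A i) (B i)) := fun i => by
    have := excess_nonneg (hA i) (hB i)
    positivity
  have hsum : ∑ i, sin (2 * α) / 2 * (1 + excess (A i) (B i)) =
      sin (2 * α) / 2 * (n + ∑ i, excess (A i) (B i)) := by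
    rw [← Finset.mul_sum, Finset.sum_add_distrib, Finset.sum_const, Finset.card_univ, ZMod.card,
      nsmul_one]
  rw [← hsum]
  refine ENNReal.toReal_le_of_le_ofReal (Finset.sum_nonneg fun i _ => hterm i) ?_
  rw [ENNReal.ofReal_sum_of_nonneg fun i _ => hterm i]
  exact hF.volume_le hA hB hQ

theorem IsPolarForm.slope_mem_Ico (hF : IsPolarForm p c θ α) (hz : z ∈ Icc (-1 : ZMod n → ℝ) 1)
    (i : ZMod n) : (1 - cos (2 * α)) * (1 - z i) ∈ Ico 0 2 ∧
      (1 - cos (2 * α)) * (1 + z (i + 1)) ∈ Ico 0 2 := by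
  have hM0 := (one_sub_cos_two_mul_pos hF.mem_Ioo).le
  have hM1 : 1 - cos (2 * α) < 1 := by linarith [cos_two_mul_pos_of_lt_pi_div_four hF.mem_Ioo]
  exact ⟨mul_one_sub_mem_Ico hM0 hM1 (slope_mem_Icc hz i),
    mul_one_add_mem_Ico hM0 hM1 (slope_mem_Icc hz (i + 1))⟩

theorem HasSlopes.area_le [NeZero n] (hQ : HasSlopes c θ α Q z) (hF : IsPolarForm p c θ α)
    (hz : z ∈ Icc (-1 : ZMod n → ℝ) 1) :
    area Q ≤ sin (2 * α) / 2 * (n + totalExcess (1 - cos (2 * α)) z) :=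
  hF.area_le (fun i => (hF.slope_mem_Ico hz i).1) (fun i => (hF.slope_mem_Ico hz i).2)
    fun _ _ _ huv => hQ.le_one hF huv

theorem HasSlopes.area_le_of_side_subset [NeZero n] (hQ : HasSlopes c θ α Q z)
    (hF : IsPolarForm p c θ α) (hz : z ∈ Icc (-1 : ZMod n → ℝ) 1) (hcirc : IsCircumscribed p Q)
    {i : ZMod n} (hi : side p i ⊆ frontier Q) :
    area Q ≤ sin (2 * α) / 2 *
      (n + (totalExcess (1 - cos (2 * α)) z - sideExcess (1 - cos (2 * α)) z i)) := by
  set A : ZMod n → ℝ := fun j => (1 - cos (2 * α)) * (1 - z j)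
  set B : ZMod n → ℝ := fun j => (1 - cos (2 * α)) * (1 + z (j + 1))
  have hsum : ∑ j, excess (Function.update A i 0 j) (B j) =
      totalExcess (1 - cos (2 * α)) z - sideExcess (1 - cos (2 * α)) z i := by
    rw [totalExcess, eq_sub_iff_add_eq, ← Finset.sum_erase_add _ _ (Finset.mem_univ i),
      ← Finset.sum_erase_add _ (sideExcess _ _) (Finset.mem_univ i), Function.update_self,
      excess_zero_left, add_zero]
    congr 1
    exact Finset.sum_congr rfl fun j hj => by
      rw [Function.update_of_ne (Finset.ne_of_mem_erase hj), sideExcess]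
  rw [← hsum]
  refine hF.area_le ?_ (fun j => (hF.slope_mem_Ico hz j).2) fun j u v huv => ?_
  · exact (Function.forall_update_iff A fun _ a => a ∈ Ico 0 2).2
      ⟨⟨le_rfl, zero_lt_two⟩, fun j _ => (hF.slope_mem_Ico hz j).1⟩
  · obtain ⟨hleft, hright⟩ := hQ.le_one hF huv
    refine ⟨?_, hright⟩
    rcases eq_or_ne j i with rfl | hji
    · rw [Function.update_self, sub_zero, one_mul]
      exact hF.add_le_one_of_side_subset hcirc hi huv
    · rwa [Function.update_of_ne hji]

end UpperBound

section Construction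

theorem cos_le_cos_of_le_of_le_two_pi_sub {a x : ℝ} (ha : 0 ≤ a) (hax : a ≤ x)
    (hxa : x ≤ 2 * π - a) : cos x ≤ cos a := by
  have hsum : 0 ≤ sin ((x + a) / 2) :=
    sin_nonneg_of_nonneg_of_le_pi (by linarith) (by linarith)
  have hdiff : 0 ≤ sin ((x - a) / 2) :=
    sin_nonneg_of_nonneg_of_le_pi (by linarith) (by linarith)
  have hprod := cos_sub_cos x a
  nlinarith [mul_nonneg hsum hdiff]

theorem cos_add_tan_mul_sin_le {α r x d : ℝ} (hc : 0 < cos α) (hr : r ∈ Icc (-1 : ℝ) 1)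
    (hprev : cos (x - α) ≤ d) (hnext : cos (x + α) ≤ d) :
    cos x + tan α * r * sin x ≤ d / cos α := by
  have heq : cos x + tan α * r * sin x =
      ((1 + r) / 2 * cos (x - α) + (1 - r) / 2 * cos (x + α)) / cos α := by
    rw [tan_eq_sin_div_cos, cos_sub, cos_add]
    field_simp
    ring
  have hprev' := mul_le_mul_of_nonneg_left hprev (by linarith [hr.1] : 0 ≤ (1 + r) / 2)
  have hnext' := mul_le_mul_of_nonneg_left hnext (by linarith [hr.2] : 0 ≤ (1 - r) / 2)
  rw [heq]
  gcongr
  linarith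

theorem mul_add_mul_le_one {u v a b g : ℝ} (hu : 0 ≤ u) (hv : 0 ≤ v) (hug : u + g * v ≤ 1)
    (hgu : g * u + v ≤ 1) (ha : a ≤ 1) (hb : b ≤ 1) (h : a ≤ g ∨ b ≤ g) : u * a + v * b ≤ 1 := by
  rcases h with h | h
  · linarith [mul_le_mul_of_nonneg_left h hu, mul_le_mul_of_nonneg_left hb hv]
  · linarith [mul_le_mul_of_nonneg_left ha hu, mul_le_mul_of_nonneg_left h hv]

variable {n : ℕ} {p : ZMod n → Plane} {c : Plane} {θ : ZMod n → ℝ} {α : ℝ} {Q : Set Plane}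
  {z : ZMod n → ℝ}

namespace IsPolarForm

theorem four_lt (hF : IsPolarForm p c θ α) : 4 < n := by
  have hn : (4 : ℝ) < n := by nlinarith [hF.natCast_mul, hF.mem_Ioo.1, hF.mem_Ioo.2]
  exact_mod_cast hn

theorem cos_add_tan_mul_sin_le_div (hF : IsPolarForm p c θ α) {r : ℝ} (hr : r ∈ Icc (-1 : ℝ) 1)
    {k l : ℕ} (hlk : l + 1 ≤ k) (hkl : k + l + 1 ≤ n) :
    cos (2 * α * k) + tan α * r * sin (2 * α * k) ≤ cos ((2 * l + 1) * α) / cos α := by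
  have hα0 := hF.mem_Ioo.1
  have hlk' : (l : ℝ) + 1 ≤ k := by exact_mod_cast hlk
  have hkl' : (k : ℝ) + l + 1 ≤ n := by exact_mod_cast hkl
  have hlow : (2 * l + 1) * α + α ≤ 2 * α * k := by nlinarith
  have hhigh : 2 * α * k + α ≤ 2 * π - (2 * l + 1) * α := by nlinarith [hF.natCast_mul]
  have ha : 0 ≤ (2 * l + 1) * α := by positivity
  apply cos_add_tan_mul_sin_le (cos_pos_of_lt_pi_div_four hF.mem_Ioo) hr <;>
    exact cos_le_cos_of_le_of_le_two_pi_sub ha (by linarith) (by linarith)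

theorem suppFun_vertex_le_one (hF : IsPolarForm p c θ α) {r : ℝ} (hr : r ∈ Icc (-1 : ℝ) 1) {k : ℕ}
    (hk : k < n) (x : ℝ) : suppFun (tan α * r) x (circ (x + 2 * α * k)) ≤ 1 := by
  rw [suppFun_circ_add]
  rcases Nat.eq_zero_or_pos k with rfl | hk0
  · simp only [Nat.cast_zero, mul_zero, cos_zero, sin_zero, add_zero, le_refl]
  · have hle := hF.cos_add_tan_mul_sin_le_div hr (l := 0) hk0 hk
    rwa [Nat.cast_zero, mul_zero, zero_add, one_mul,
      div_self (cos_pos_of_lt_pi_div_four hF.mem_Ioo).ne'] at hle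

theorem suppFun_vertex_le_of_two_le (hF : IsPolarForm p c θ α) {r : ℝ} (hr : r ∈ Icc (-1 : ℝ) 1)
    {k : ℕ} (hk2 : 2 ≤ k) (hk : k + 2 ≤ n) (x : ℝ) :
    suppFun (tan α * r) x (circ (x + 2 * α * k)) ≤ 1 - 2 * (1 - cos (2 * α)) := by
  have hle := hF.cos_add_tan_mul_sin_le_div hr (l := 1) hk2 hk
  have hthree : cos (3 * α) / cos α = 1 - 2 * (1 - cos (2 * α)) := by
    rw [div_eq_iff (cos_pos_of_lt_pi_div_four hF.mem_Ioo).ne', cos_three_mul, cos_two_mul]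
    ring
  rw [suppFun_circ_add, ← hthree]
  convert hle using 3
  norm_num

theorem suppFun_apex_le_one [NeZero n] (hF : IsPolarForm p c θ α)
    (hz : z ∈ Icc (-1 : ZMod n → ℝ) 1) {j : ZMod n} {u v : ℝ} (hu : 0 ≤ u) (hv : 0 ≤ v)
    (hleft : u + (1 - (1 - cos (2 * α)) * (1 - z j)) * v ≤ 1)
    (hright : (1 - (1 - cos (2 * α)) * (1 + z (j + 1))) * u + v ≤ 1) (i : ZMod n) :
    suppFun (tan α * z i) (θ i) (u • circ (θ j) + v • circ (θ j + 2 * α)) ≤ 1 := by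
  obtain ⟨k, hkn, rfl⟩ := exists_eq_add_natCast i j
  rcases Nat.eq_zero_or_pos k with rfl | hk0
  · rw [Nat.cast_zero, add_zero] at hleft ⊢
    rwa [suppFun_side_left hF.mem_Ioo]
  rcases (Nat.succ_le_of_lt hkn).eq_or_lt with hkn1 | hkn1
  · have hi : i = i + k + 1 := by
      rw [add_assoc, ← Nat.cast_succ, hkn1, ZMod.natCast_self, add_zero]
    rw [← hi] at hright
    rwa [hi, hF.suppFun_angle_add_one, ← hi, suppFun_side_right hF.mem_Ioo]
  have hr := slope_mem_Icc hz i
  have hM := (one_sub_cos_two_mul_pos hF.mem_Ioo).le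
  have hnext : circ (θ (i + k) + 2 * α) = circ (θ i + 2 * α * (k + 1 : ℕ)) := by
    rw [circ_add_congr (hF.circ_angle_add i k)]
    push_cast
    ring_nf
  rw [hnext, hF.circ_angle_add, map_add, map_smul, map_smul, smul_eq_mul, smul_eq_mul]
  refine mul_add_mul_le_one (g := 1 - 2 * (1 - cos (2 * α))) hu hv ?_ ?_
    (hF.suppFun_vertex_le_one hr hkn _) (hF.suppFun_vertex_le_one hr hkn1 _) ?_
  · nlinarith [mul_nonneg (mul_nonneg hM hv) (by linarith [(slope_mem_Icc hz (i + k)).1] :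
      0 ≤ 1 + z (i + k))]
  · nlinarith [mul_nonneg (mul_nonneg hM hu) (by linarith [(slope_mem_Icc hz (i + k + 1)).2] :
      0 ≤ 1 - z (i + k + 1))]
  · have hn := hF.four_lt
    rcases eq_or_ne k 1 with hk1 | hk1
    · right
      exact hF.suppFun_vertex_le_of_two_le hr (by omega) (by omega) _
    · left
      exact hF.suppFun_vertex_le_of_two_le hr (by omega) hkn1 _

end IsPolarForm

/-- The convex hull of the center `c`, the vertices `p i` and the apices `c + q i`. -/
def apexHull (p : ZMod n → Plane) (c : Plane) (q : ZMod n → Plane) : Set Plane :=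
  convexHull ℝ (insert c (range p ∪ range fun i => c + q i))

theorem hasSlopes_convexHull {F : Set Plane} (hF : HasSlopes c θ α F z) :
    HasSlopes c θ α (convexHull ℝ F) z := by
  intro i
  refine convexHull_min (t := {x | suppFun (tan α * z i) (θ i) (x - c) ≤ 1}) (hF i) ?_
  simp only [map_sub, sub_le_iff_le_add]
  exact convex_halfSpace_le (suppFun (tan α * z i) (θ i)).isLinear _

theorem IsPolarForm.hasSlopes_apexHull [NeZero n] (hF : IsPolarForm p c θ α)
    (hz : z ∈ Icc (-1 : ZMod n → ℝ) 1) {u v : ZMod n → ℝ} (hu : ∀ i, 0 ≤ u i) (hv : ∀ i, 0 ≤ v i)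
    (hleft : ∀ i, u i + (1 - (1 - cos (2 * α)) * (1 - z i)) * v i ≤ 1)
    (hright : ∀ i, (1 - (1 - cos (2 * α)) * (1 + z (i + 1))) * u i + v i ≤ 1) :
    HasSlopes c θ α (apexHull p c fun i => u i • circ (θ i) + v i • circ (θ i + 2 * α)) z := by
  apply hasSlopes_convexHull
  rintro i x (rfl | ⟨j, rfl⟩ | ⟨j, rfl⟩)
  · rw [sub_self, map_zero]
    exact zero_le_one
  · obtain ⟨k, hkn, rfl⟩ := exists_eq_add_natCast i j
    rw [hF.vertex_add, add_sub_cancel_left]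
    exact hF.suppFun_vertex_le_one (slope_mem_Icc hz i) hkn _
  · rw [add_sub_cancel_left]
    exact hF.suppFun_apex_le_one hz (hu j) (hv j) (hleft j) (hright j) i

theorem IsPolarForm.le_volume [NeZero n] (hF : IsPolarForm p c θ α) (hQ : Convex ℝ Q) (hc : c ∈ Q)
    (hp : ∀ i, p i ∈ Q) {u v : ZMod n → ℝ} (hu : ∀ i, 0 < u i) (hv : ∀ i, 0 < v i)
    (hq : ∀ i, c + (u i • circ (θ i) + v i • circ (θ i + 2 * α)) ∈ Q) :
    ENNReal.ofReal (sin (2 * α) / 2 * ∑ i, (u i + v i)) ≤ volume Q := by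
  set T : ZMod n → Set Plane := fun i =>
    kite openStdTriangle (circ (θ i)) (circ (θ i + 2 * α))
      (u i • circ (θ i) + v i • circ (θ i + 2 * α))
  have hs := sin_two_mul_pos_of_lt_pi_div_four hF.mem_Ioo
  have hsub : ⋃ i, T i ⊆ (c + ·) ⁻¹' Q := iUnion_subset fun i =>
    kite_subset hQ hc (hF.vertex i ▸ hp i) (hF.vertex_add_one i ▸ hp (i + 1)) (hq i)
  have hdisj : Pairwise (Function.onFun (AEDisjoint volume) T) := by
    refine fun i j hij => Disjoint.aedisjoint (Set.disjoint_left.2 fun x hx hx' => hij ?_)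
    obtain ⟨s, t, hs, ht, hst⟩ := exists_pos_combination_of_mem_kite (hu i) (hv i) hx
    obtain ⟨s', t', hs', ht', hst'⟩ := exists_pos_combination_of_mem_kite (hu j) (hv j) hx'
    exact hF.eq_of_combination_eq hs ht hs' ht' (hst.symm.trans hst')
  have hvol : ∀ i, volume (T i) = ENNReal.ofReal (sin (2 * α) / 2 * (u i + v i)) := fun i => by
    rw [volume_kite_openStdTriangle (by rwa [cross_circ]) (hu i) (hv i), cross_circ]
  rw [← measure_preimage_add volume c Q]
  refine le_of_eq_of_le ?_ (measure_mono hsub)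
  rw [measure_iUnion₀ hdisj fun i => nullMeasurableSet_kite _ _ _, tsum_fintype, Finset.mul_sum,
    ENNReal.ofReal_sum_of_nonneg fun i _ =>
      mul_nonneg (by positivity) (add_pos (hu i) (hv i)).le]
  exact Finset.sum_congr rfl fun i _ => (hvol i).symm

theorem HasSlopes.isMaxOn (hQ : HasSlopes c θ α Q z) {i : ZMod n} {x : Plane}
    (hx : suppFun (tan α * z i) (θ i) (x - c) = 1) :
    IsMaxOn (suppFun (tan α * z i) (θ i)) Q x := by
  intro y hy
  have hle := hQ i y hy
  rw [← hx, map_sub, map_sub, sub_le_sub_iff_right] at hle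
  exact hle

theorem HasSlopes.vertex_mem_frontier (hQ : HasSlopes c θ α Q z) (hF : IsPolarForm p c θ α)
    {i : ZMod n} (hi : p i ∈ Q) : p i ∈ frontier Q := by
  refine mem_frontier_of_isMaxOn (suppFun_ne_zero _ _) hi (hQ.isMaxOn (i := i) ?_)
  rw [hF.vertex, add_sub_cancel_left, suppFun_circ_self]

theorem IsPolarForm.exists_isCircumscribed [NeZero n] (hF : IsPolarForm p c θ α)
    (hz : z ∈ Icc (-1 : ZMod n → ℝ) 1) :
    ∃ Q, IsCircumscribed p Q ∧ HasSlopes c θ α Q z ∧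
      sin (2 * α) / 2 * (n + totalExcess (1 - cos (2 * α)) z) ≤ area Q := by
  choose u v hu hv huv hleft hright using fun i =>
    exists_apex_pos (hF.slope_mem_Ico hz i).1 (hF.slope_mem_Ico hz i).2
  set q : ZMod n → Plane := fun i => u i • circ (θ i) + v i • circ (θ i + 2 * α)
  have hslopes : HasSlopes c θ α (apexHull p c q) z :=
    hF.hasSlopes_apexHull hz (fun i => (hu i).le) (fun i => (hv i).le) hleft hright
  have hfin : (insert c (range p ∪ range fun i => c + q i)).Finite :=
    ((finite_range _).union (finite_range _)).insert c
  have hsubset := subset_convexHull ℝ (insert c (range p ∪ range fun i => c + q i))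
  have hvertex : ∀ i, p i ∈ apexHull p c q := fun i => hsubset (Or.inr (Or.inl ⟨i, rfl⟩))
  have hvol := hF.le_volume (convex_convexHull ℝ _) (hsubset (Or.inl rfl)) hvertex hu hv
    fun i => hsubset (Or.inr (Or.inr ⟨i, rfl⟩))
  have hsum : ∑ i, (u i + v i) = n + totalExcess (1 - cos (2 * α)) z := by
    rw [Finset.sum_congr rfl fun i _ => huv i, Finset.sum_add_distrib, Finset.sum_const,
      Finset.card_univ, ZMod.card, nsmul_one]
    rfl
  have hpos : 0 < sin (2 * α) / 2 * ∑ i, (u i + v i) :=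
    mul_pos (half_pos (sin_two_mul_pos_of_lt_pi_div_four hF.mem_Ioo))
      (Finset.sum_pos (fun i _ => add_pos (hu i) (hv i)) Finset.univ_nonempty)
  have hint : (interior (apexHull p c q)).Nonempty :=
    interior_nonempty_of_measure_ne_zero volume (convex_convexHull ℝ _)
      ((ENNReal.ofReal_pos.2 hpos).trans_le hvol).ne'
  refine ⟨apexHull p c q, ⟨⟨⟨_, hfin, rfl⟩, hint⟩, ?_, fun i =>
    hslopes.vertex_mem_frontier hF (hvertex i)⟩, hslopes, ?_⟩
  · exact convexHull_mono fun x hx => Or.inr (Or.inl hx)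
  · rw [← hsum]
    exact (ENNReal.ofReal_le_iff_le_toReal (hfin.isCompact_convexHull ℝ).measure_lt_top.ne).1 hvol

theorem HasSlopes.side_subset_frontier (hQ : HasSlopes c θ α Q z) (hF : IsPolarForm p c θ α)
    (hcirc : IsCircumscribed p Q) (hz : z ∈ Icc (-1 : ZMod n → ℝ) 1) {i : ZMod n}
    (hi : sideExcess (1 - cos (2 * α)) z i = 0) : side p i ⊆ frontier Q := by
  obtain ⟨hA, hB⟩ := hF.slope_mem_Ico hz i
  have hside : ∀ j, suppFun (tan α * z j) (θ j) (p i - c) = 1 →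
      suppFun (tan α * z j) (θ j) (p (i + 1) - c) = 1 → side p i ⊆ frontier Q := fun j h0 h1 =>
    segment_subset_frontier_of_isMaxOn hcirc.convex (suppFun_ne_zero _ _) (hcirc.vertex_mem i)
      (hcirc.vertex_mem (i + 1)) (hQ.isMaxOn h0) (hQ.isMaxOn h1)
  rw [hF.vertex_add_one, hF.vertex i, add_sub_cancel_left, add_sub_cancel_left] at hside
  have hzero : (1 - cos (2 * α)) * (1 - z i) = 0 ∨ (1 - cos (2 * α)) * (1 + z (i + 1)) = 0 := by
    by_contra! hne
    exact ((excess_pos_iff hA hB).2 ⟨hA.1.lt_of_ne' hne.1, hB.1.lt_of_ne' hne.2⟩).ne' hi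
  rcases hzero with h0 | h0
  · apply hside i (suppFun_circ_self _ _)
    simpa only [h0, zero_smul, one_smul, zero_add, sub_zero, one_mul] using
      suppFun_side_left hF.mem_Ioo (θ i) (z i) 0 1
  · have hright := hside (i + 1)
    rw [hF.suppFun_angle_add_one] at hright
    refine hright ?_ (suppFun_circ_self _ _)
    simpa only [h0, zero_smul, one_smul, add_zero, sub_zero, mul_one] using
      suppFun_side_right hF.mem_Ioo (θ i) (z (i + 1)) 1 0

end Construction

section Words

open Classical in
/-- The label of the `j`-th side in the extremal sequence with a gap of length `m`. -/
def gapLabel (m j : ℕ) : Label := if IsUsed m j then Label.U else Label.N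

/-- The extremal sequence of length `n` with a gap of length `m`. -/
def gapWord (n m : ℕ) : List Label := (List.range n).map (gapLabel m)

theorem gapLabel_zero_add_two (j : ℕ) : gapLabel 0 (j + 2) = gapLabel 0 j := by
  simp only [gapLabel, isUsed_zero_iff, Nat.even_add, even_two, iff_true]

theorem gapWord_two_mul_zero (k : ℕ) : gapWord (2 * k) 0 = wordUN k := by
  induction k with
  | zero => rfl
  | succ k ih =>
    have hzero : gapLabel 0 0 = Label.U := if_pos (Or.inl rfl)
    have hone : gapLabel 0 1 = Label.N := if_neg (by simp [isUsed_zero_iff])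
    rw [wordUN, List.replicate_succ, List.flatten_cons, ← wordUN, ← ih, gapWord, Nat.mul_succ,
      List.range_succ_eq_map, List.range_succ_eq_map, List.map_cons, List.map_cons, List.map_cons,
      List.map_map, List.map_map, hzero, hone]
    congr 2
    exact List.map_congr_left fun j _ => gapLabel_zero_add_two j

theorem gapWord_add_two_mul (m k : ℕ) : gapWord (m + 1 + 2 * k) (m + 1) = wordUNUN m k := by
  have hzero : gapLabel (m + 1) 0 = Label.U := if_pos (Or.inl rfl)
  have hgap : (List.range m).map (gapLabel (m + 1) ∘ Nat.succ) = List.replicate m Label.N := by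
    refine List.eq_replicate_iff.2 ⟨by simp, fun l hl => ?_⟩
    obtain ⟨j, hj, rfl⟩ := List.mem_map.1 hl
    rw [List.mem_range] at hj
    exact if_neg fun hused => by rcases hused with h | h <;> omega
  have htail : ∀ j, gapLabel (m + 1) (m + 1 + j) = gapLabel 0 j := fun j => by
    have hused : IsUsed (m + 1) (m + 1 + j) ↔ IsUsed 0 j := by
      rw [isUsed_zero_iff, IsUsed, Nat.add_sub_cancel_left]
      exact ⟨fun h => h.elim (fun h0 => by omega) And.right,
        fun h => Or.inr ⟨Nat.le_add_right _ _, h⟩⟩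
    classical exact if_congr hused rfl rfl
  rw [gapWord, List.range_add, List.map_append, List.range_succ_eq_map, List.map_cons,
    List.map_map, List.map_map, hzero, hgap, wordUNUN, ← gapWord_two_mul_zero, List.cons_append]
  congr 2
  exact List.map_congr_left fun j _ => htail j

theorem rotate_assignedSequence {n : ℕ} [NeZero n] {p : ZMod n → Plane} {Q : Set Plane} {m : ℕ}
    {a : ZMod n} (ha : ∀ j < n, side p (a + (j : ZMod n)) ⊆ frontier Q ↔ IsUsed m j) :
    (assignedSequence p Q).rotate a.val = gapWord n m := by
  have hlen : (assignedSequence p Q).length = n := List.length_ofFn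
  refine List.ext_getElem (by simp [hlen, gapWord]) fun j _ hj => ?_
  have hjn : j < n := by simpa [gapWord] using hj
  have hindex : (((j + a.val) % n : ℕ) : ZMod n) = a + (j : ZMod n) := by
    rw [ZMod.natCast_mod, Nat.cast_add, ZMod.natCast_zmod_val, add_comm]
  have hleft : ((assignedSequence p Q).rotate a.val)[j] = sideLabel p Q (a + (j : ZMod n)) := by
    simp only [List.getElem_rotate, hlen, ← hindex]
    exact List.getElem_ofFn _
  have hright : (gapWord n m)[j] = gapLabel m j := by
    simp only [gapWord, List.getElem_map, List.getElem_range]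
  rw [hleft, hright]
  classical exact if_congr (ha j hjn) rfl rfl

end Words

section Conclusion

theorem sin_two_mul_div_two_mul {α : ℝ} (hα : α ∈ Ioo 0 (π / 4)) (N X : ℝ) :
    sin (2 * α) / 2 * (N + (N * tan α ^ 2 + tan α ^ 3 * X)) =
      N * tan α + sin α ^ 4 / cos α ^ 2 * X := by
  have hc := (cos_pos_of_lt_pi_div_four hα).ne'
  rw [sin_two_mul, tan_eq_sin_div_cos]
  field_simp
  linear_combination N * sin α * cos α * sin_sq_add_cos_sq α

theorem gapValue_of_two_mul_add_eq {n m k : ℕ} {α : ℝ} (hα : n * α = π) (h : 2 * m + k = n) :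
    gapValue α n m = ((n : ℝ) + k) / 4 * tan (2 * α) - tan (k * α / 2) := by
  have hcast : (2 : ℝ) * m + k = n := by exact_mod_cast h
  have hangle : m * α - π / 2 = -(k * α / 2) := by
    rw [← hα]
    linear_combination α / 2 * hcast
  rw [gapValue, hangle, tan_neg]
  linear_combination -tan (2 * α) / 4 * hcast

variable {n : ℕ} [NeZero n] {p : ZMod n → Plane} {c : Plane} {θ : ZMod n → ℝ} {α V : ℝ} {m : ℕ}
  {Q : Set Plane} {z : ZMod n → ℝ}

namespace IsPolarForm

theorem area_le_of_forall_totalExcess_le (hF : IsPolarForm p c θ α)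
    (hV : ∀ z ∈ Icc (-1 : ZMod n → ℝ) 1, totalExcess (1 - cos (2 * α)) z ≤ V)
    (hQ : IsCircumscribed p Q) : area Q ≤ sin (2 * α) / 2 * (n + V) := by
  obtain ⟨z, hz, hslopes⟩ := hF.exists_hasSlopes hQ
  have hs := sin_two_mul_pos_of_lt_pi_div_four hF.mem_Ioo
  refine (hslopes.area_le hF hz).trans ?_
  gcongr
  exact hV z hz

theorem bddAbove_circumscribedAreas (hF : IsPolarForm p c θ α) :
    BddAbove (circumscribedAreas p) := by
  obtain ⟨w, -, hmax⟩ := exists_isMaxOn_totalExcess (n := n) (one_sub_cos_two_mul_pos hF.mem_Ioo).le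
    (by linarith [cos_two_mul_pos_of_lt_pi_div_four hF.mem_Ioo])
  refine ⟨sin (2 * α) / 2 * (n + totalExcess (1 - cos (2 * α)) w), ?_⟩
  rintro _ ⟨Q, hQ, rfl⟩
  exact hF.area_le_of_forall_totalExcess_le (fun z hz => hmax hz) hQ

theorem isGreatest_circumscribedAreas (hF : IsPolarForm p c θ α)
    (hV : IsOptimum n (1 - cos (2 * α)) V m) :
    IsGreatest (circumscribedAreas p) (sin (2 * α) / 2 * (n + V)) := by
  obtain ⟨z, hz, rfl, -⟩ := hV.attained
  obtain ⟨Q, hQ, -, harea⟩ := hF.exists_isCircumscribed hz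
  refine ⟨⟨Q, hQ, (hF.area_le_of_forall_totalExcess_le hV.le hQ).antisymm harea⟩, ?_⟩
  rintro _ ⟨Q', hQ', rfl⟩
  exact hF.area_le_of_forall_totalExcess_le hV.le hQ'

theorem totalExcess_eq (hF : IsPolarForm p c θ α) (hV : IsOptimum n (1 - cos (2 * α)) V m)
    (hQ : IsMaxAreaCircumscribed p Q) (hz : z ∈ Icc (-1 : ZMod n → ℝ) 1)
    (hslopes : HasSlopes c θ α Q z) : totalExcess (1 - cos (2 * α)) z = V := by
  have hs := half_pos (sin_two_mul_pos_of_lt_pi_div_four hF.mem_Ioo)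
  have harea := hslopes.area_le hF hz
  rw [hQ.2, maxArea, (hF.isGreatest_circumscribedAreas hV).csSup_eq] at harea
  exact (hV.le z hz).antisymm ((add_le_add_iff_left _).1 (le_of_mul_le_mul_left harea hs))

theorem side_subset_frontier_iff (hF : IsPolarForm p c θ α)
    (hV : IsOptimum n (1 - cos (2 * α)) V m) (hQ : IsMaxAreaCircumscribed p Q)
    (hz : z ∈ Icc (-1 : ZMod n → ℝ) 1) (hslopes : HasSlopes c θ α Q z) (i : ZMod n) :
    side p i ⊆ frontier Q ↔ sideExcess (1 - cos (2 * α)) z i = 0 := by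
  refine ⟨fun hi => ?_, hslopes.side_subset_frontier hF hQ.1 hz⟩
  have hs := half_pos (sin_two_mul_pos_of_lt_pi_div_four hF.mem_Ioo)
  have hnonneg : 0 ≤ sideExcess (1 - cos (2 * α)) z i :=
    excess_nonneg (hF.slope_mem_Ico hz i).1 (hF.slope_mem_Ico hz i).2
  have harea := hslopes.area_le_of_side_subset hF hz hQ.1 hi
  rw [hQ.2, maxArea, (hF.isGreatest_circumscribedAreas hV).csSup_eq,
    hF.totalExcess_eq hV hQ hz hslopes] at harea
  linarith [le_of_mul_le_mul_left harea hs]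

theorem exists_assignedSequence_eq (hF : IsPolarForm p c θ α)
    (hV : IsOptimum n (1 - cos (2 * α)) V m) :
    ∃ Q, IsMaxAreaCircumscribed p Q ∧ assignedSequence p Q = gapWord n m := by
  obtain ⟨z, hz, htotal, hpattern⟩ := hV.attained
  obtain ⟨Q, hQ, hslopes, harea⟩ := hF.exists_isCircumscribed hz
  have hmax : IsMaxAreaCircumscribed p Q := by
    rw [htotal] at harea
    refine ⟨hQ, ?_⟩
    rw [maxArea, (hF.isGreatest_circumscribedAreas hV).csSup_eq]
    exact (hF.area_le_of_forall_totalExcess_le hV.le hQ).antisymm harea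
  refine ⟨Q, hmax, ?_⟩
  have hrotate := rotate_assignedSequence (p := p) (Q := Q) (m := m) (a := 0) fun j hj => by
    rw [hF.side_subset_frontier_iff hV hmax hz hslopes, zero_add]
    exact hpattern j hj
  rwa [ZMod.val_zero, List.rotate_zero] at hrotate

theorem isRotated_assignedSequence (hF : IsPolarForm p c θ α)
    (hV : IsOptimum n (1 - cos (2 * α)) V m) (hQ : IsMaxAreaCircumscribed p Q) :
    List.IsRotated (assignedSequence p Q) (gapWord n m) := by
  obtain ⟨z, hz, hslopes⟩ := hF.exists_hasSlopes hQ.1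
  obtain ⟨a, ha⟩ := hV.pattern z hz (hF.totalExcess_eq hV hQ hz hslopes)
  refine ⟨a.val, rotate_assignedSequence fun j hj => ?_⟩
  rw [hF.side_subset_frontier_iff hV hQ hz hslopes]
  exact ha j hj

end IsPolarForm

theorem maxArea_and_assignedSequence_of_isOptimalGap (hn : 5 ≤ n) (hp : IsUnitRegularNgon p)
    (hm : IsOptimalGap n m) :
    maxArea p =
        n * tan (π / n) + sin (π / n) ^ 4 / cos (π / n) ^ 2 * gapValue (π / n) n m ∧
      (∃ Q, IsMaxAreaCircumscribed p Q ∧ assignedSequence p Q = gapWord n m) ∧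
      ∀ Q, IsMaxAreaCircumscribed p Q → List.IsRotated (assignedSequence p Q) (gapWord n m) := by
  obtain ⟨c, θ, hF⟩ := hp.exists_isPolarForm hn
  have hV := isOptimum_of_isOptimalGap hF.mem_Ioo hF.natCast_mul hm
  rw [← sin_two_mul_div_two_mul hF.mem_Ioo]
  exact ⟨(hF.isGreatest_circumscribedAreas hV).csSup_eq, hF.exists_assignedSequence_eq hV,
    fun Q => hF.isRotated_assignedSequence hV⟩

theorem maxArea_and_assignedSequence_of_two_dvd (hn : 5 ≤ n) (hp : IsUnitRegularNgon p)
    (h : 2 ∣ n) :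
    maxArea p = n * tan (π / n) +
        (n : ℝ) / 2 * (sin (π / n) ^ 4 / cos (π / n) ^ 2) * tan (2 * π / n) ∧
      (∃ Q, IsMaxAreaCircumscribed p Q ∧ assignedSequence p Q = wordUN (n / 2)) ∧
      ∀ Q, IsMaxAreaCircumscribed p Q → List.IsRotated (assignedSequence p Q) (wordUN (n / 2)) := by
  obtain ⟨harea, hword⟩ := maxArea_and_assignedSequence_of_isOptimalGap hn hp
    (Or.inl ⟨even_iff_two_dvd.2 h, rfl⟩)
  rw [← gapWord_two_mul_zero, Nat.mul_div_cancel' h]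
  refine ⟨?_, hword⟩
  rw [harea, gapValue_zero, ← mul_div_assoc 2 π]
  ring

theorem maxArea_and_assignedSequence_of_four_dvd {k : ℕ} (hn : 5 ≤ n) (hp : IsUnitRegularNgon p)
    (hk : k = 1 ∨ k = 3) (h : 4 ∣ n + k) :
    maxArea p = n * tan (π / n) + sin (π / n) ^ 4 / cos (π / n) ^ 2 *
        (((n : ℝ) + k) / 4 * tan (2 * π / n) - tan (k * π / (2 * n))) ∧
      (∃ Q, IsMaxAreaCircumscribed p Q ∧
        assignedSequence p Q = wordUNUN ((n - (k + 2)) / 2) ((n + k) / 4)) ∧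
      ∀ Q, IsMaxAreaCircumscribed p Q →
        List.IsRotated (assignedSequence p Q) (wordUNUN ((n - (k + 2)) / 2) ((n + k) / 4)) := by
  have hgap : IsOptimalGap n ((n - (k + 2)) / 2 + 1) :=
    Or.inr ⟨Nat.odd_iff.2 (by omega), Nat.odd_iff.2 (by omega), by omega, by omega⟩
  have hlength : (n - (k + 2)) / 2 + 1 + 2 * ((n + k) / 4) = n := by omega
  obtain ⟨harea, hword⟩ := maxArea_and_assignedSequence_of_isOptimalGap hn hp hgap
  rw [← gapWord_add_two_mul, hlength]
  refine ⟨?_, hword⟩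
  rw [harea, gapValue_of_two_mul_add_eq (k := k) (mul_div_cancel₀ π (NeZero.ne (n : ℝ))) (by omega)]
  congr 4 <;> ring_nf

end Conclusion

end CircumscribedPolygon

end

theorem mainTheorem6 (n : ℕ) (hn : 5 ≤ n) (p : ZMod n → CircumscribedPolygon.Plane)
    (hp : CircumscribedPolygon.IsUnitRegularNgon p) :
    BddAbove (CircumscribedPolygon.circumscribedAreas p) ∧
    (2 ∣ n →
      CircumscribedPolygon.maxArea p =
        n * Real.tan (Real.pi / n) +
          (n : ℝ) / 2 * (Real.sin (Real.pi / n) ^ 4 / Real.cos (Real.pi / n) ^ 2) *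
            Real.tan (2 * Real.pi / n) ∧
      (∃ Q, CircumscribedPolygon.IsMaxAreaCircumscribed p Q ∧
        CircumscribedPolygon.assignedSequence p Q = CircumscribedPolygon.wordUN (n / 2)) ∧
      ∀ Q, CircumscribedPolygon.IsMaxAreaCircumscribed p Q →
        List.IsRotated (CircumscribedPolygon.assignedSequence p Q)
          (CircumscribedPolygon.wordUN (n / 2))) ∧
    (4 ∣ n - 1 →
      CircumscribedPolygon.maxArea p =
        n * Real.tan (Real.pi / n) +
          Real.sin (Real.pi / n) ^ 4 / Real.cos (Real.pi / n) ^ 2 *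
            (((n : ℝ) + 3) / 4 * Real.tan (2 * Real.pi / n) -
              Real.tan (3 * Real.pi / (2 * n))) ∧
      (∃ Q, CircumscribedPolygon.IsMaxAreaCircumscribed p Q ∧
        CircumscribedPolygon.assignedSequence p Q =
          CircumscribedPolygon.wordUNUN ((n - 5) / 2) ((n + 3) / 4)) ∧
      ∀ Q, CircumscribedPolygon.IsMaxAreaCircumscribed p Q →
        List.IsRotated (CircumscribedPolygon.assignedSequence p Q)
          (CircumscribedPolygon.wordUNUN ((n - 5) / 2) ((n + 3) / 4))) ∧
    (4 ∣ n + 1 →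
      CircumscribedPolygon.maxArea p =
        n * Real.tan (Real.pi / n) +
          Real.sin (Real.pi / n) ^ 4 / Real.cos (Real.pi / n) ^ 2 *
            (((n : ℝ) + 1) / 4 * Real.tan (2 * Real.pi / n) -
              Real.tan (Real.pi / (2 * n))) ∧
      (∃ Q, CircumscribedPolygon.IsMaxAreaCircumscribed p Q ∧
        CircumscribedPolygon.assignedSequence p Q =
          CircumscribedPolygon.wordUNUN ((n - 3) / 2) ((n + 1) / 4)) ∧
      ∀ Q, CircumscribedPolygon.IsMaxAreaCircumscribed p Q →
        List.IsRotated (CircumscribedPolygon.assignedSequence p Q)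
          (CircumscribedPolygon.wordUNUN ((n - 3) / 2) ((n + 1) / 4))) := by
  open CircumscribedPolygon in
  have : NeZero n := ⟨by omega⟩
  obtain ⟨c, θ, hF⟩ := hp.exists_isPolarForm hn
  refine ⟨hF.bddAbove_circumscribedAreas, maxArea_and_assignedSequence_of_two_dvd hn hp,
    fun h => ?_, fun h => ?_⟩
  · have h3 : 4 ∣ n + 3 := by omega
    simpa only [Nat.cast_ofNat] using
      maxArea_and_assignedSequence_of_four_dvd hn hp (Or.inr rfl) h3
  · simpa only [Nat.cast_one, one_mul] using
      maxArea_and_assignedSequence_of_four_dvd hn hp (Or.inl rfl) h
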